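/- **Setting.** Let $n\ge 1$, let $\mathcal X\subseteq\mathbb R^d$, and let $\|\cdot\|$ be the Euclidean norm (the induced $2$-norm for matrices). For each node $i\in\{1,\dots,n\}$ and time $t\ge 1$ let $f_{i,t}:\mathcal X\to\mathbb R$ and $g_{i,t}:\mathcal X\to\mathbb R^m$, and set $f_t=\frac1n\sum_{i=1}^n f_{i,t}$. Assume: (A) $\mathbf W\in\mathbb R^{n\times n}$ is symmetric and doubly stochastic with non-negative entries, its positive off-diagonal entries are exactly those on the edges of a connected undirected graph on the nodes, and $\sigma_2(\mathbf W)<1$, where $\sigma_2=\sigma_2(\mathbf W)$ is the second largest modulus of an eigenvalue of $\mathbf W$, counted with multiplicity ($\sigma_2=0$ if $n=1$). (B) $\mathcal X$ is convex and compact, and there are constants $d(\mathcal X)>0$, $L\ge0$, $F>0$, $G>0$ such that $\|x-y\|\le d(\mathcal X)$ on $\mathcal X$ and, for all $i$ and all $t\ge1$, the functions $f_{i,t}$ and $g_{i,t}$ are convex ($g_{i,t}$ componentwise), $L$-Lipschitz, bounded in norm by $F$, and differentiable on $\mathcal X$ with gradients (Jacobians) bounded in norm by $G$. (C) $\mathcal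 R:\mathcal X\to\mathbb R$ is differentiable and, for some $\mu>0$, $\mathcal R(x)\ge\mathcal R(y)+\langle\nabla\mathcal R(y),x-y\rangle+\frac\mu2\|x-y\|^2$ on $\mathcal X$. Its Bregman divergence $\mathcal D_{\mathcal R}(x,y)=\mathcal R(x)-\mathcal R(y)-\langle x-y,\nabla\mathcal R(y)\rangle$ is convex in $y\in\mathcal X$ for every $x\in\mathcal X$, and, for some $K\ge 0$, $|\mathcal D_{\mathcal R}(x,y)-\mathcal D_{\mathcal R}(z,y)|\le K\|x-z\|$ for all $x,y,z\in\mathcal X$. **Algorithm.** Let $0<b<a<1$ and $\alpha_t=t^{-a}$, $\beta_t=t^{-b}$, $\gamma_t=t^{-(1-b)}$. Assume $\mathbf 0\in\mathcal X$. Start from $x_{i,0}=\mathbf 0$, $q_{i,0}=\mathbf 0$, $f_{i,0}\equiv 0$, $g_{i,0}\equiv \mathbf 0$ (with zero gradients). For $t=1,2,\dots$ and every node $i$ put $$a_{i,t}=\nabla f_{i,t-1}(x_{i,t-1})+[\nabla g_{i,t-1}(x_{i,t-1})]^{\mathsf T}q_{i,t-1},\qquad y_{i,t}\in\operatorname*{argmin}_{x\in\mathcal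 X}\{\alpha_t\langle x,a_{i,t}\rangle+\mathcal D_{\mathcal R}(x,x_{i,t-1})\},$$ $$b_{i,t}=\nabla g_{i,t-1}(x_{i,t-1})(y_{i,t}-x_{i,t-1})+g_{i,t-1}(x_{i,t-1}),\qquad q_{i,t}=[q_{i,t-1}+\gamma_t(b_{i,t}-\beta_tq_{i,t-1})]_+,\qquad x_{i,t}=\sum_{j=1}^n[\mathbf W]_{ij}\,y_{j,t},$$ where $[\cdot]_+$ is the projection onto the non-negative orthant. **Claim.** For every $t\ge1$ let $x_t^*$ be a minimizer of $f_t$ over $\{x\in\mathcal X: g_{i,t}(x)\le\mathbf 0\ \text{for all } i\}$, and set $C_T^*=\sum_{t=1}^T\|x^*_{t+1}-x^*_t\|$ and $\mathbf{Reg}^d_T=\frac1n\sum_{i=1}^n\sum_{t=1}^T f_t(x_{i,t})-\sum_{t=1}^T f_t(x_t^*)$. Then for every integer $T\ge 1$, $$\mathbf{Reg}_T^d\le R_1T^{\max\{a,\,1-a+b\}}+2KT^aC_T^*,$$ $$\frac1{n^2}\sum_{i=1}^n\sum_{j=1}^n\Big\|\Big[\sum_{t=1}^T g_{i,t}(x_{j,t})\Big]_+\Big\|^2\le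 D_1T^{2-b}+D_2T^{1+a-b}C_T^*+D_3T^{2+2b-2a},$$ where $$B_1=2F+G\,d(\mathcal X),\qquad R=\frac{2(1+F)LG\sqrt n\,\sigma_2}{\mu(1-a)(1-\sigma_2)},\qquad R_1=R+\frac{B_1^2}{2b}+\frac{G^2}{\mu(1-a)}+2K\,d(\mathcal X),$$ $$D=2+\frac{4G^2}{\mu(1-a)}+\frac2{1-b},\qquad D_1=2D\Big(2F+2K\,d(\mathcal X)+\frac{B_1^2}{2b}+\frac{G^2}{\mu(1-a)}+2K\,d(\mathcal X)\Big),\qquad D_2=4KD,\qquad D_3=2R^2.$$ -/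

import Mathlib

/-- Euclidean space of dimension `k`. -/
abbrev Vec (k : ℕ) : Type := EuclideanSpace ℝ (Fin k)

/-- The projection onto the non-negative orthant: the coordinatewise positive part. -/
noncomputable def posProj {m : ℕ} (v : Vec m) : Vec m :=
  WithLp.toLp 2 (fun k => max (v k) 0)

/-- The second largest modulus of an eigenvalue: the moduli of the real roots of the characteristic
polynomial, with multiplicity, are listed in decreasing order and the second entry is taken
(`0` if there is no second entry, as for a `1 × 1` matrix). All eigenvalues of a symmetric matrix
are real. -/
noncomputable def secondEigenvalueModulus {n : ℕ} (W : Matrix (Fin n) (Fin n) ℝ) : ℝ :=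
  ((W.charpoly.roots.map (fun z => |z|)).sort (· ≥ ·)).getD 1 0

/-- The weight matrix of a connected undirected network: symmetric, doubly stochastic (with
non-negative entries), with positive off-diagonal entries exactly on the edges. The weights that
the nodes give to themselves are only required to be non-negative. -/
structure IsNetworkWeight {n : ℕ} (G : SimpleGraph (Fin n)) (W : Matrix (Fin n) (Fin n) ℝ) :
    Prop where
  connected : G.Connected
  pos_iff_adj : ∀ i j, i ≠ j → (0 < W i j ↔ G.Adj i j)
  symm : W.IsSymm
  doublyStochastic : W ∈ doublyStochastic ℝ (Fin n)

/-- The functions revealed to the nodes: the loss `f i t` and the constraint function `g i t` of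
node `i` at time `t`, with the gradient `gradf i t` and the Jacobian `jacg i t`. Only the values
on the action set matter. -/
structure OnlineData (n d m : ℕ) where
  f : Fin n → ℕ → Vec d → ℝ
  gradf : Fin n → ℕ → Vec d → Vec d
  g : Fin n → ℕ → Vec d → Vec m
  jacg : Fin n → ℕ → Vec d → (Vec d →L[ℝ] Vec m)

/-- The standing assumptions on the action set `X` and on the revealed functions, with diameter
bound `dX`, Lipschitz constant `L`, bound `F` on the values and bound `G` on the gradients.
Differentiability is relative to `X`; the norm of a Jacobian is the operator norm. -/
structure IsRegularProblem {n d m : ℕ} (X : Set (Vec d)) (P : OnlineData n d m)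
    (dX L F G : ℝ) : Prop where
  convex_set : Convex ℝ X
  compact_set : IsCompact X
  diam_pos : 0 < dX
  diam_le : ∀ x ∈ X, ∀ y ∈ X, ‖x - y‖ ≤ dX
  L_nonneg : 0 ≤ L
  lipschitz_f : ∀ i, ∀ t, 1 ≤ t → ∀ x ∈ X, ∀ y ∈ X, |P.f i t x - P.f i t y| ≤ L * ‖x - y‖
  lipschitz_g : ∀ i, ∀ t, 1 ≤ t → ∀ x ∈ X, ∀ y ∈ X, ‖P.g i t x - P.g i t y‖ ≤ L * ‖x - y‖
  convex_f : ∀ i, ∀ t, 1 ≤ t → ConvexOn ℝ X (P.f i t)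
  convex_g : ∀ i, ∀ t, 1 ≤ t → ∀ k : Fin m, ConvexOn ℝ X (fun x => P.g i t x k)
  F_pos : 0 < F
  bound_f : ∀ i, ∀ t, 1 ≤ t → ∀ x ∈ X, |P.f i t x| ≤ F
  bound_g : ∀ i, ∀ t, 1 ≤ t → ∀ x ∈ X, ‖P.g i t x‖ ≤ F
  hasGradient_f : ∀ i, ∀ t, 1 ≤ t → ∀ x ∈ X,
    HasGradientWithinAt (P.f i t) (P.gradf i t x) X x
  hasJacobian_g : ∀ i, ∀ t, 1 ≤ t → ∀ x ∈ X,
    HasFDerivWithinAt (P.g i t) (P.jacg i t x) X x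
  G_pos : 0 < G
  bound_gradf : ∀ i, ∀ t, 1 ≤ t → ∀ x ∈ X, ‖P.gradf i t x‖ ≤ G
  bound_jacg : ∀ i, ∀ t, 1 ≤ t → ∀ x ∈ X, ‖P.jacg i t x‖ ≤ G

/-- `R` is differentiable on `X` with gradient `gradR`, and `μ`-strongly convex there. -/
structure IsStronglyConvexMirrorMap {d : ℕ} (X : Set (Vec d)) (R : Vec d → ℝ)
    (gradR : Vec d → Vec d) (μ : ℝ) : Prop where
  mu_pos : 0 < μ
  hasGradient : ∀ x ∈ X, HasGradientWithinAt R (gradR x) X x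
  strongly_convex : ∀ x ∈ X, ∀ y ∈ X,
    R x ≥ R y + inner ℝ (gradR y) (x - y) + μ / 2 * ‖x - y‖ ^ 2

/-- The Bregman divergence of `R`. -/
noncomputable def bregman {d : ℕ} (R : Vec d → ℝ) (gradR : Vec d → Vec d) (x y : Vec d) : ℝ :=
  R x - R y - inner ℝ (x - y) (gradR y)

/-- The Bregman divergence is convex in its second argument and `K`-Lipschitz in its first. -/
structure IsRegularBregman {d : ℕ} (X : Set (Vec d)) (R : Vec d → ℝ)
    (gradR : Vec d → Vec d) (K : ℝ) : Prop where
  separately_convex : ∀ x ∈ X, ConvexOn ℝ X (fun y => bregman R gradR x y)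
  K_nonneg : 0 ≤ K
  lipschitz : ∀ x ∈ X, ∀ y ∈ X, ∀ z ∈ X,
    |bregman R gradR x y - bregman R gradR z y| ≤ K * ‖x - z‖

/-- The direction of the primal update that is computed from the data of time `t` at the action
`x` and the dual variable `q`: the gradient of the loss plus the transposed Jacobian of the
constraint applied to `q`. -/
noncomputable def primalDirection {n d m : ℕ} (P : OnlineData n d m) (i : Fin n) (t : ℕ)
    (x : Vec d) (q : Vec m) : Vec d :=
  P.gradf i t x + ContinuousLinearMap.adjoint (P.jacg i t x) q

/-- The sequences `x`, `y`, `q` are generated by the distributed primal-dual mirror descent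
algorithm on the action set `X`, with weights `W`, mirror map `R` and step sizes `α`, `β`, `γ`.
The functions of time `0` vanish; round `t + 1` uses the data of time `t`. -/
structure IsAlgorithmRun {n d m : ℕ} (X : Set (Vec d)) (P : OnlineData n d m)
    (W : Matrix (Fin n) (Fin n) ℝ) (R : Vec d → ℝ) (gradR : Vec d → Vec d)
    (α β γ : ℕ → ℝ) (x y : Fin n → ℕ → Vec d) (q : Fin n → ℕ → Vec m) : Prop where
  zero_mem : (0 : Vec d) ∈ X
  f_zero : ∀ i, ∀ z ∈ X, P.f i 0 z = 0 ∧ P.gradf i 0 z = 0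
  g_zero : ∀ i, ∀ z ∈ X, P.g i 0 z = 0 ∧ P.jacg i 0 z = 0
  x_zero : ∀ i, x i 0 = 0
  q_zero : ∀ i, q i 0 = 0
  primal_mem : ∀ i t, y i (t + 1) ∈ X
  primal_min : ∀ i t, IsMinOn
    (fun z => α (t + 1) * inner ℝ z (primalDirection P i t (x i t) (q i t))
      + bregman R gradR z (x i t)) X (y i (t + 1))
  dual : ∀ i t, q i (t + 1) = posProj (q i t + γ (t + 1) •
    ((P.jacg i t (x i t) (y i (t + 1) - x i t) + P.g i t (x i t)) - β (t + 1) • q i t))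
  consensus : ∀ i t, x i (t + 1) = ∑ j, W i j • y j (t + 1)

/-- The global loss at time `t`: the average of the local losses. -/
noncomputable def globalLoss {n d m : ℕ} (P : OnlineData n d m) (t : ℕ) (x : Vec d) : ℝ :=
  (1 / (n : ℝ)) * ∑ i, P.f i t x

/-- The actions at time `t` that satisfy the constraints of all nodes. -/
def feasibleSet {n d m : ℕ} (X : Set (Vec d)) (P : OnlineData n d m) (t : ℕ) : Set (Vec d) :=
  {x | x ∈ X ∧ ∀ i, ∀ k : Fin m, P.g i t x k ≤ 0}

/-- `xs t` minimizes the global loss over the feasible actions at every time `t ≥ 1`. -/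
def IsComparator {n d m : ℕ} (X : Set (Vec d)) (P : OnlineData n d m) (xs : ℕ → Vec d) : Prop :=
  ∀ t, 1 ≤ t → xs t ∈ feasibleSet X P t ∧ IsMinOn (globalLoss P t) (feasibleSet X P t) (xs t)

/-- The dynamic regret up to time `T`. -/
noncomputable def dynamicRegret {n d m : ℕ} (P : OnlineData n d m) (x : Fin n → ℕ → Vec d)
    (xs : ℕ → Vec d) (T : ℕ) : ℝ :=
  (1 / (n : ℝ)) * ∑ i, ∑ t ∈ Finset.Icc 1 T, globalLoss P t (x i t)
    - ∑ t ∈ Finset.Icc 1 T, globalLoss P t (xs t)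

/-- The averaged squared fit up to time `T`. -/
noncomputable def squaredFit {n d m : ℕ} (P : OnlineData n d m) (x : Fin n → ℕ → Vec d)
    (T : ℕ) : ℝ :=
  (1 / (n : ℝ)) * ∑ i, (1 / (n : ℝ)) * ∑ j,
    ‖posProj (∑ t ∈ Finset.Icc 1 T, P.g i t (x j t))‖ ^ 2

/-- The path length `C_T^*` of the comparator sequence. -/
noncomputable def pathLength {d : ℕ} (xs : ℕ → Vec d) (T : ℕ) : ℝ :=
  ∑ t ∈ Finset.Icc 1 T, ‖xs (t + 1) - xs t‖

/-- The constant `B₁`. -/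
def constB₁ (dX F G : ℝ) : ℝ := 2 * F + G * dX

/-- The constant `R` that accounts for the disagreement between the nodes, with
`σ = σ₂(W)`. -/
noncomputable def constR (n : ℕ) (σ L F G μ a : ℝ) : ℝ :=
  2 * (1 + F) * L * G * Real.sqrt n * σ / (μ * (1 - a) * (1 - σ))

/-- The constant `R₁`. -/
noncomputable def constR₁ (n : ℕ) (σ dX L F G μ K a b : ℝ) : ℝ :=
  constR n σ L F G μ a + constB₁ dX F G ^ 2 / (2 * b) + G ^ 2 / (μ * (1 - a)) + 2 * K * dX

/-- The constant `D`. -/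
noncomputable def constD (G μ a b : ℝ) : ℝ :=
  2 + 4 * G ^ 2 / (μ * (1 - a)) + 2 / (1 - b)

/-- The constant `D₁`. -/
noncomputable def constD₁ (dX F G μ K a b : ℝ) : ℝ :=
  2 * constD G μ a b * (2 * F + 2 * K * dX + constB₁ dX F G ^ 2 / (2 * b)
    + G ^ 2 / (μ * (1 - a)) + 2 * K * dX)

/-- The constant `D₂`. -/
noncomputable def constD₂ (G μ K a b : ℝ) : ℝ := 4 * K * constD G μ a b

/-- The constant `D₃`. -/
noncomputable def constD₃ (n : ℕ) (σ L F G μ a : ℝ) : ℝ := 2 * constR n σ L F G μ a ^ 2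

/-! The proof separates an optimization error at each node from the disagreement between nodes.

For the first, fix a feasible action and a multiplier `l ≥ 0`. The three-point inequality of the
mirror step, the expanded square of the dual step and convexity bound loss gap plus `⟨l, g(x)⟩`
(`IsRegularProblem.primal_dual_step_le`). The linearized constraint weighted by `q` cancels between
the two steps, and strong convexity pays for evaluating at `x` rather than `y`. Summed over time,
the dual distances telescope because `1/γ` grows by at most `β` per round (`dual_telescope_le`). The
Bregman terms telescope with weights `1/α`: mixing does not increase the total divergence, by
convexity in the second argument, and a moving comparator costs `K` times its path length
(`sum_bregman_le`). The outcome is `sum_lagrangian_le`, valid for all `l ≥ 0`.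

For the second, `W` contracts zero-sum vectors by `σ₂` (`sum_sq_mulVec_le`), so the disagreement is
a geometric recursion driven by the mirror step lengths. These are at most of order `α_{t+1} t^b`,
since `‖q_t‖ ≤ F t^b` (`norm_q_le`); their sum is of order `T^(1-a+b)` (`sum_disagreement_le`).

Taking `l = 0` gives the regret. Taking `l` proportional to the positive part of the accumulated
constraints, which maximizes the linear term minus the quadratic penalty, gives the fit. -/

/-! ### First-order convexity relative to a set -/

/-- The first-order inequality of a convex function whose derivative is relative to its domain. -/
theorem ConvexOn.add_hasFDerivWithinAt_le {E : Type*} [NormedAddCommGroup E] [NormedSpace ℝ E]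
    {X : Set E} {f : E → ℝ} {f' : E →L[ℝ] ℝ} {x z : E} (hf : ConvexOn ℝ X f)
    (hf' : HasFDerivWithinAt f f' X x) (hx : x ∈ X) (hz : z ∈ X) :
    f x + f' (z - x) ≤ f z := by
  -- Restricting to the segment from `x` to `z` leaves a convex function on `[0, 1]`, whose
  -- one-sided derivative at 0 is at most its slope; `x` may lie on the boundary.
  have hmap : Set.MapsTo (AffineMap.lineMap x z : ℝ → E) (Set.Icc 0 1) X := fun s hs =>
    hf.1.lineMap_mem hx hz hs
  have hconv : ConvexOn ℝ (Set.Icc (0 : ℝ) 1) (f ∘ (AffineMap.lineMap x z : ℝ →ᵃ[ℝ] E)) :=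
    (hf.comp_affineMap (AffineMap.lineMap x z)).subset hmap (convex_Icc 0 1)
  have hline : HasDerivWithinAt (AffineMap.lineMap x z : ℝ → E) (z - x) (Set.Icc 0 1) 0 :=
    (AffineMap.hasDerivAt_lineMap).hasDerivWithinAt
  have hder : HasDerivWithinAt (f ∘ (AffineMap.lineMap x z : ℝ → E)) (f' (z - x))
      (Set.Icc 0 1) 0 := by
    refine HasFDerivWithinAt.comp_hasDerivWithinAt (t := X) 0 ?_ hline hmap
    simpa using hf'
  have h := hconv.le_slope_of_hasDerivWithinAt (by simp) (by simp) zero_lt_one hder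
  simp [slope_def_field] at h
  rw [map_sub]
  linarith

/-! ### Estimates for the step sizes -/

/-- Bernoulli's inequality for `(1 - 1/u)^(1-p)` with `u = t + 1`, multiplied by `u^(1-p)`. It
bounds one term of the `p`-series by a telescoping difference. -/
theorem rpow_sub_one_bound {p : ℝ} (hp0 : 0 < p) (hp1 : p < 1) (t : ℕ) :
    (1 - p) * (1 / ((t + 1 : ℕ) : ℝ) ^ p) + (t : ℝ) ^ (1 - p) ≤ ((t + 1 : ℕ) : ℝ) ^ (1 - p) := by
  set u : ℝ := ((t + 1 : ℕ) : ℝ) with hu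
  have hu0 : 0 < u := by positivity
  have hu1 : 1 ≤ u := by rw [hu]; push_cast; linarith [Nat.cast_nonneg (α := ℝ) t]
  have ht : (t : ℝ) = u * (1 + -(1 / u)) := by
    rw [hu]; push_cast at *; field_simp; ring
  have hinv : 1 / u ≤ 1 := by rw [div_le_one hu0]; exact hu1
  have hbern := rpow_one_add_le_one_add_mul_self (s := -(1 / u)) (p := 1 - p) (by linarith)
    (by linarith) (by linarith)
  have hpow : 1 / u ^ p = u ^ (1 - p) * (1 / u) := by
    rw [Real.rpow_sub hu0, Real.rpow_one]; field_simp
  rw [ht, Real.mul_rpow hu0.le (by linarith), hpow]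
  have := mul_le_mul_of_nonneg_left hbern (Real.rpow_nonneg hu0.le (1 - p))
  linarith

/-- Comparison of a shifted `p`-series, `p < 1`, with the integral of `t ^ (-p)`. -/
theorem sum_one_div_rpow_succ_le {p : ℝ} (hp0 : 0 < p) (hp1 : p < 1) (T : ℕ) :
    ∑ t ∈ Finset.Icc 1 T, 1 / ((t + 1 : ℕ) : ℝ) ^ p ≤ (T : ℝ) ^ (1 - p) / (1 - p) := by
  have h1p : 0 < 1 - p := by linarith
  induction T with
  | zero => simp [Real.zero_rpow h1p.ne']
  | succ T ih =>
    rw [Finset.sum_Icc_succ_top (by omega)]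
    have hb := rpow_sub_one_bound hp0 hp1 T
    have hmono : 1 / ((T + 1 + 1 : ℕ) : ℝ) ^ p ≤ 1 / ((T + 1 : ℕ) : ℝ) ^ p := by
      apply one_div_le_one_div_of_le (by positivity)
      apply Real.rpow_le_rpow (by positivity) _ hp0.le
      push_cast; linarith
    have h2 : 1 / ((T + 1 : ℕ) : ℝ) ^ p ≤
        (((T + 1 : ℕ) : ℝ) ^ (1 - p) - (T : ℝ) ^ (1 - p)) / (1 - p) := by
      rw [le_div_iff₀ h1p]; linarith
    rw [sub_div] at h2
    linarith

/-- In terms of the step sizes: `1/γ` increases by at most `β`, which lets the dual regularization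
absorb the changing weights in `dual_telescope_le`. -/
theorem rpow_succ_sub_le {b : ℝ} (hb0 : 0 < b) (t : ℕ) (ht : 1 ≤ t) :
    ((t + 1 : ℕ) : ℝ) ^ (1 - b) - (t : ℝ) ^ (1 - b) ≤ 1 / ((t + 1 : ℕ) : ℝ) ^ b := by
  have ht0 : (0 : ℝ) < t := by exact_mod_cast ht
  have hs0 : (0 : ℝ) < ((t + 1 : ℕ) : ℝ) := by positivity
  rw [Real.rpow_sub hs0, Real.rpow_sub ht0, Real.rpow_one, Real.rpow_one]
  have : (t : ℝ) / ((t + 1 : ℕ) : ℝ) ^ b ≤ t / (t : ℝ) ^ b := by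
    apply div_le_div_of_nonneg_left ht0.le (by positivity)
    apply Real.rpow_le_rpow ht0.le _ hb0.le
    push_cast; linarith
  have e : ((t + 1 : ℕ) : ℝ) / ((t + 1 : ℕ) : ℝ) ^ b
      = (t : ℝ) / ((t + 1 : ℕ) : ℝ) ^ b + 1 / ((t + 1 : ℕ) : ℝ) ^ b := by
    push_cast; ring
  linarith

/-- Removes the shift in `1/α_{T+1}`; the factor 2 in the `2K` terms of the bounds comes from here.
-/
theorem rpow_succ_le_two_mul {a : ℝ} (ha0 : 0 ≤ a) (ha1 : a ≤ 1) (T : ℕ) (hT : 1 ≤ T) :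
    ((T + 1 : ℕ) : ℝ) ^ a ≤ 2 * (T : ℝ) ^ a := by
  have hT1 : (1 : ℝ) ≤ T := by exact_mod_cast hT
  calc ((T + 1 : ℕ) : ℝ) ^ a ≤ (2 * (T : ℝ)) ^ a := by
        apply Real.rpow_le_rpow (by positivity) _ ha0
        push_cast; linarith
    _ = (2 : ℝ) ^ a * (T : ℝ) ^ a := Real.mul_rpow (by norm_num) (by linarith)
    _ ≤ 2 * (T : ℝ) ^ a := by
        gcongr
        calc (2 : ℝ) ^ a ≤ 2 ^ (1 : ℝ) := Real.rpow_le_rpow_of_exponent_le (by norm_num) ha1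
          _ = 2 := Real.rpow_one 2

/-! ### Spectral contraction of the weight matrix -/

theorem secondEigenvalueModulus_nonneg {n : ℕ} (W : Matrix (Fin n) (Fin n) ℝ) :
    0 ≤ secondEigenvalueModulus W := by
  unfold secondEigenvalueModulus
  rw [List.getD_eq_getElem?_getD]
  cases h : ((W.charpoly.roots.map (fun z => |z|)).sort (· ≥ ·))[1]? with
  | none => simp
  | some v =>
    have hv := List.mem_of_getElem? h
    rw [Multiset.mem_sort, Multiset.mem_map] at hv
    obtain ⟨z, -, rfl⟩ := hv
    simp

/-- All eigenvalues but one have modulus at most the second largest modulus. -/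
theorem exists_forall_ne_abs_eigenvalues_le {n : ℕ} (hn : 0 < n) {W : Matrix (Fin n) (Fin n) ℝ}
    (hW : W.IsHermitian) :
    ∃ k₀, ∀ k, k ≠ k₀ → |hW.eigenvalues k| ≤ secondEigenvalueModulus W := by
  have hroots : W.charpoly.roots = Multiset.map hW.eigenvalues Finset.univ.val :=
    hW.roots_charpoly_eq_eigenvalues
  have hpair := (W.charpoly.roots.map (fun z => |z|)).pairwise_sort (· ≥ ·)
  have hsort := (W.charpoly.roots.map (fun z => |z|)).sort_eq (· ≥ ·)
  unfold secondEigenvalueModulus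
  set l := (W.charpoly.roots.map (fun z => |z|)).sort (· ≥ ·)
  rw [hroots, Multiset.map_map] at hsort
  match l, hpair, hsort with
  | [], _, hsort =>
    have := congrArg Multiset.card hsort
    simp at this
    omega
  | x :: rest, hpair, hsort =>
    have hx : x ∈ Multiset.map ((fun z => |z|) ∘ hW.eigenvalues) Finset.univ.val := by
      rw [← hsort]; simp
    obtain ⟨k₀, hk₀, rfl⟩ := Multiset.mem_map.1 hx
    refine ⟨k₀, fun k hk => ?_⟩
    -- Cancelling the head against the index `k₀` identifies `rest` with the moduli at all other
    -- indices, so multiplicities are respected.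
    rw [← Multiset.cons_erase hk₀, Multiset.map_cons, ← Multiset.cons_coe,
      Multiset.cons_inj_right] at hsort
    have hmem : |hW.eigenvalues k| ∈ rest := by
      rw [← Multiset.mem_coe, hsort]
      exact Multiset.mem_map.2 ⟨k, (Multiset.mem_erase_of_ne hk).2 (Finset.mem_univ k), rfl⟩
    match rest, hpair, hmem with
    | v :: tail, hpair, hmem =>
      simp only [List.getD_cons_succ, List.getD_cons_zero]
      rcases List.mem_cons.1 hmem with h | h
      · exact h.le
      · exact (List.pairwise_cons.1 (List.pairwise_cons.1 hpair).2).1 _ h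

/-- A symmetric stochastic matrix contracts the vectors with zero sum. -/
theorem sum_sq_mulVec_le {n : ℕ} {W : Matrix (Fin n) (Fin n) ℝ} (hsymm : W.IsSymm)
    (hds : W ∈ doublyStochastic ℝ (Fin n)) (hσ : secondEigenvalueModulus W < 1)
    (v : Fin n → ℝ) (hv : ∑ i, v i = 0) :
    ∑ i, (∑ j, W i j * v j) ^ 2 ≤ secondEigenvalueModulus W ^ 2 * ∑ i, v i ^ 2 := by
  rcases Nat.eq_zero_or_pos n with rfl | hn
  · simp
  have hW : W.IsHermitian := by
    rw [Matrix.IsHermitian, Matrix.conjTranspose_eq_transpose_of_trivial]; exact hsymm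
  obtain ⟨k₀, hk₀⟩ := exists_forall_ne_abs_eigenvalues_le hn hW
  set σ := secondEigenvalueModulus W
  set u := hW.eigenvectorBasis with hu
  have hself : ∀ (k : Fin n) (w : EuclideanSpace ℝ (Fin n)),
      inner ℝ (u k) (WithLp.toLp 2 (W.mulVec w)) = hW.eigenvalues k * inner ℝ (u k) w := by
    intro k w
    have h1 := hW.mulVec_eigenvectorBasis k
    have h2 : inner ℝ (u k) (WithLp.toLp 2 (W.mulVec w)) = (W.mulVec (u k)) ⬝ᵥ w := by
      rw [EuclideanSpace.inner_eq_star_dotProduct]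
      simp only [star_trivial]
      rw [dotProduct_comm, Matrix.dotProduct_mulVec, ← Matrix.mulVec_transpose, hsymm.eq]
    have h3 : inner ℝ (u k) w = (u k : Fin n → ℝ) ⬝ᵥ w := by
      rw [EuclideanSpace.inner_eq_star_dotProduct]
      simp [dotProduct_comm]
    rw [h2, h3, h1, smul_dotProduct]; rfl
  set e : EuclideanSpace ℝ (Fin n) := WithLp.toLp 2 1 with he
  have hWe : WithLp.toLp 2 (W.mulVec e) = e := by
    rw [he]; congr 1; exact mulVec_one_of_mem_doublyStochastic hds
  -- The all-ones vector is fixed by `W`, hence orthogonal to every eigenvector with eigenvalue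
  -- below 1.
  have horth : ∀ k, k ≠ k₀ → inner ℝ (u k) e = 0 := by
    intro k hk
    have h1 := hself k e
    rw [hWe] at h1
    have h2 : hW.eigenvalues k < 1 := lt_of_le_of_lt ((le_abs_self _).trans (hk₀ k hk)) hσ
    have h3 : (1 - hW.eigenvalues k) * inner ℝ (u k) e = 0 := by linarith
    rcases mul_eq_zero.1 h3 with h | h
    · linarith
    · exact h
  set w : EuclideanSpace ℝ (Fin n) := WithLp.toLp 2 v with hw
  have hew : inner ℝ e w = 0 := by
    simp [he, hw, PiLp.inner_apply, hv]
  have hexp := u.sum_inner_mul_inner e w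
  -- Only the index `k₀` survives in the expansion of `⟨e, w⟩ = 0`. As `e ≠ 0` must have a component
  -- along `u k₀`, the vector `w` has none, and the sum of squares involves only eigenvalues of
  -- modulus at most `σ`.
  have hsingle : inner ℝ e (u k₀) * inner ℝ (u k₀) w = 0 := by
    rw [hew, Finset.sum_eq_single k₀ (fun k _ hk => by
      rw [real_inner_comm, horth k hk, zero_mul]) (by simp)] at hexp
    exact hexp
  have hne : inner ℝ e (u k₀) ≠ 0 := by
    intro h0
    have hee := u.sum_inner_mul_inner e e
    rw [Finset.sum_eq_zero (fun k _ => ?_)] at hee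
    · have : e = 0 := inner_self_eq_zero.1 hee.symm
      have := congrArg (fun z : EuclideanSpace ℝ (Fin n) => z ⟨0, hn⟩) this
      simp [he] at this
    · by_cases hk : k = k₀
      · rw [hk, h0, zero_mul]
      · rw [horth k hk, mul_zero]
  have hwk₀ : inner ℝ (u k₀) w = 0 := (mul_eq_zero.1 hsingle).resolve_left hne
  have hl : ∑ i, (∑ j, W i j * v j) ^ 2 = ‖WithLp.toLp 2 (W.mulVec w)‖ ^ 2 := by
    rw [EuclideanSpace.real_norm_sq_eq]; rfl
  have hr : ∑ i, v i ^ 2 = ‖w‖ ^ 2 := by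
    rw [EuclideanSpace.real_norm_sq_eq]
  rw [hl, hr, ← u.sum_sq_norm_inner_right, ← u.sum_sq_norm_inner_right, Finset.mul_sum]
  refine Finset.sum_le_sum fun k _ => ?_
  rw [hself k w]
  by_cases hk : k = k₀
  · rw [hk, hwk₀]; simp
  · rw [norm_mul, mul_pow]
    gcongr
    exact hk₀ k hk

/-! ### Disagreement between the nodes -/

/-- The average of the states of the nodes. -/
noncomputable def nodeMean {n d : ℕ} (x : Fin n → Vec d) : Vec d := (1 / (n : ℝ)) • ∑ i, x i

/-- The `ℓ²` distance of the states of the nodes to consensus. -/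
noncomputable def disagreement {n d : ℕ} (x : Fin n → Vec d) : ℝ :=
  ‖(WithLp.toLp 2 (fun i => x i - nodeMean x) : PiLp 2 (fun _ : Fin n => Vec d))‖

theorem disagreement_nonneg {n d : ℕ} (x : Fin n → Vec d) : 0 ≤ disagreement x := norm_nonneg _

theorem disagreement_sq {n d : ℕ} (x : Fin n → Vec d) :
    disagreement x ^ 2 = ∑ i, ‖x i - nodeMean x‖ ^ 2 := by
  rw [disagreement, PiLp.norm_sq_eq_of_L2]

theorem sum_eq_smul_nodeMean {n d : ℕ} (hn : 0 < n) (x : Fin n → Vec d) :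
    ∑ i, x i = (n : ℝ) • nodeMean x := by
  have : (n : ℝ) ≠ 0 := by positivity
  rw [nodeMean, smul_smul, mul_one_div_cancel this, one_smul]

theorem norm_sub_le_two_mul_disagreement {n d : ℕ} (x : Fin n → Vec d) (i j : Fin n) :
    ‖x i - x j‖ ≤ 2 * disagreement x := by
  have h : ∀ k, ‖x k - nodeMean x‖ ≤ disagreement x := fun k =>
    PiLp.norm_apply_le (WithLp.toLp 2 (fun i => x i - nodeMean x) : PiLp 2 _) k
  calc ‖x i - x j‖ = ‖(x i - nodeMean x) - (x j - nodeMean x)‖ := by congr 1; abel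
    _ ≤ ‖x i - nodeMean x‖ + ‖x j - nodeMean x‖ := norm_sub_le _ _
    _ ≤ 2 * disagreement x := by linarith [h i, h j]

theorem disagreement_eq_zero {n d : ℕ} (x : Fin n → Vec d) (hx : ∀ i, x i = 0) :
    disagreement x = 0 := by
  have hm : nodeMean x = 0 := by simp [nodeMean, hx]
  have : disagreement x ^ 2 = 0 := by rw [disagreement_sq]; simp [hx, hm]
  simpa using this

/-- Subtracting the mean is an orthogonal projection. -/
theorem disagreement_le_norm {n d : ℕ} (hn : 0 < n) (e : Fin n → Vec d) :
    disagreement e ≤ ‖(WithLp.toLp 2 e : PiLp 2 (fun _ : Fin n => Vec d))‖ := by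
  apply le_of_sq_le_sq _ (norm_nonneg _)
  rw [disagreement_sq, PiLp.norm_sq_eq_of_L2]
  have h1 : ∀ i, ‖e i - nodeMean e‖ ^ 2
      = ‖e i‖ ^ 2 - 2 * inner ℝ (e i) (nodeMean e) + ‖nodeMean e‖ ^ 2 :=
    fun i => norm_sub_sq_real _ _
  simp only [h1, Finset.sum_add_distrib, Finset.sum_sub_distrib, ← Finset.mul_sum, ← sum_inner,
    sum_eq_smul_nodeMean hn, inner_smul_left, real_inner_self_eq_norm_sq]
  simp
  nlinarith [mul_nonneg (Nat.cast_nonneg (α := ℝ) n) (sq_nonneg ‖nodeMean e‖)]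

/-- Centering is linear, so the disagreement is a seminorm. Displacements of size `ε` at `n` nodes
have joint `ℓ²` norm at most `√n ε`, the source of `√n` in `constR`. -/
theorem disagreement_le_add {n d : ℕ} (hn : 0 < n) (x y : Fin n → Vec d) {ε : ℝ} (hε : 0 ≤ ε)
    (h : ∀ i, ‖y i - x i‖ ≤ ε) : disagreement y ≤ disagreement x + Real.sqrt n * ε := by
  have hsplit : (WithLp.toLp 2 (fun i => y i - nodeMean y) : PiLp 2 (fun _ : Fin n => Vec d))
      = WithLp.toLp 2 (fun i => x i - nodeMean x)
        + WithLp.toLp 2 (fun i => (y i - x i) - nodeMean (fun i => y i - x i)) := by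
    rw [← WithLp.toLp_add]
    congr 1
    funext i
    simp only [Pi.add_apply, nodeMean, Finset.sum_sub_distrib, smul_sub]
    abel
  have htri : disagreement y ≤ disagreement x + disagreement (fun i => y i - x i) := by
    rw [disagreement, hsplit]; exact norm_add_le _ _
  have hle := disagreement_le_norm hn (fun i => y i - x i)
  have hb : ‖(WithLp.toLp 2 (fun i => y i - x i) : PiLp 2 (fun _ : Fin n => Vec d))‖
      ≤ Real.sqrt n * ε := by
    apply le_of_sq_le_sq _ (by positivity)
    rw [PiLp.norm_sq_eq_of_L2, mul_pow, Real.sq_sqrt (Nat.cast_nonneg n)]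
    calc ∑ i, ‖y i - x i‖ ^ 2 ≤ ∑ _i : Fin n, ε ^ 2 :=
          Finset.sum_le_sum fun i _ => pow_le_pow_left₀ (norm_nonneg _) (h i) 2
      _ = n * ε ^ 2 := by simp
  linarith

/-- Averaging with the network weights contracts the disagreement. -/
theorem disagreement_mix_le {n d : ℕ} (hn : 0 < n) {W : Matrix (Fin n) (Fin n) ℝ}
    (hsymm : W.IsSymm) (hds : W ∈ doublyStochastic ℝ (Fin n))
    (hσ : secondEigenvalueModulus W < 1) (y : Fin n → Vec d) :
    disagreement (fun i => ∑ j, W i j • y j) ≤ secondEigenvalueModulus W * disagreement y := by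
  -- Unit column sums preserve the mean; unit row sums make mixing commute with centering (`hmix`).
  -- The scalar contraction then applies to each coordinate of the centered states.
  have hmean : nodeMean (fun i => ∑ j, W i j • y j) = nodeMean y := by
    rw [nodeMean, nodeMean, Finset.sum_comm]
    congr 1
    refine Finset.sum_congr rfl fun j _ => ?_
    rw [← Finset.sum_smul, sum_col_of_mem_doublyStochastic hds, one_smul]
  set v : Fin n → Vec d := fun i => y i - nodeMean y with hv
  have hmix : ∀ i, ∑ j, W i j • y j - nodeMean y = ∑ j, W i j • v j := by
    intro i
    simp only [hv, smul_sub, Finset.sum_sub_distrib, ← Finset.sum_smul,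
      sum_row_of_mem_doublyStochastic hds, one_smul]
  have hsum : ∑ i, v i = 0 := by
    rw [hv, Finset.sum_sub_distrib, sum_eq_smul_nodeMean hn, Finset.sum_const, Finset.card_fin,
      Nat.cast_smul_eq_nsmul, sub_self]
  apply le_of_sq_le_sq _ (mul_nonneg (secondEigenvalueModulus_nonneg W) (disagreement_nonneg y))
  rw [mul_pow, disagreement_sq, disagreement_sq, hmean]
  simp only [hmix]
  simp only [EuclideanSpace.real_norm_sq_eq]
  rw [Finset.sum_comm, Finset.sum_comm (γ := Fin n), Finset.mul_sum]
  refine Finset.sum_le_sum fun k _ => ?_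
  have hk : ∑ i, v i k = 0 := by
    have := congrArg (fun z : Vec d => z k) hsum
    simpa using this
  have := sum_sq_mulVec_le hsymm hds hσ (fun i => v i k) hk
  simpa [hv] using this

/-! ### The mirror descent step -/

/-- The three-point inequality of a mirror descent step. -/
theorem IsStronglyConvexMirrorMap.inner_sub_le {d : ℕ} {X : Set (Vec d)} (hX : Convex ℝ X)
    {R : Vec d → ℝ} {gradR : Vec d → Vec d} {μ : ℝ} (hR : IsStronglyConvexMirrorMap X R gradR μ)
    {α : ℝ} {v x y z : Vec d} (hy : y ∈ X) (hz : z ∈ X)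
    (hmin : IsMinOn (fun z => α * inner ℝ z v + bregman R gradR z x) X y) :
    α * inner ℝ (y - z) v ≤ bregman R gradR z x - bregman R gradR z y - bregman R gradR y x := by
  have hgrad := (hR.hasGradient y hy).hasFDerivWithinAt
  have hlin : ∀ w : Vec d, HasFDerivWithinAt (fun z : Vec d => inner ℝ z w)
      (innerSL ℝ w) X y := by
    intro w
    have := (innerSL ℝ w).hasFDerivWithinAt (s := X) (x := y)
    refine this.congr' (fun z _ => ?_) hy
    simp [real_inner_comm]
  have hder : HasFDerivWithinAt (fun z => α * inner ℝ z v + bregman R gradR z x)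
      (α • innerSL ℝ v + (InnerProductSpace.toDual ℝ (Vec d) (gradR y)
        - innerSL ℝ (gradR x))) X y := by
    have hc := ((hlin v).const_mul α).add
      (((hgrad.sub_const (R x)).sub ((hlin (gradR x)).sub_const (inner ℝ x (gradR x)))))
    refine hc.congr' (fun z _ => ?_) hy
    simp [bregman, inner_sub_left]
  -- First-order optimality of `y` in the feasible direction `z - y`. The resulting gradient
  -- difference of `R` equals the three Bregman terms of the claim.
  have hpos := hmin.localize.hasFDerivWithinAt_nonneg hder
    (sub_mem_posTangentConeAt_of_segment_subset (hX.segment_subset hy hz))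
  simp only [add_apply, smul_apply,
    sub_apply, innerSL_apply_apply, InnerProductSpace.toDual_apply_apply,
    smul_eq_mul, inner_sub_right] at hpos
  simp only [bregman, inner_sub_left]
  simp only [real_inner_comm] at hpos ⊢
  linarith

theorem IsStronglyConvexMirrorMap.le_bregman {d : ℕ} {X : Set (Vec d)}
    {R : Vec d → ℝ} {gradR : Vec d → Vec d} {μ : ℝ} (hR : IsStronglyConvexMirrorMap X R gradR μ)
    {x y : Vec d} (hx : x ∈ X) (hy : y ∈ X) :
    μ / 2 * ‖x - y‖ ^ 2 ≤ bregman R gradR x y := by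
  have := hR.strongly_convex x hx y hy
  rw [bregman, real_inner_comm]
  linarith

theorem bregman_self {d : ℕ} (R : Vec d → ℝ) (gradR : Vec d → Vec d) (x : Vec d) :
    bregman R gradR x x = 0 := by simp [bregman]

/-- A mirror descent step is short. -/
theorem IsStronglyConvexMirrorMap.norm_step_le {d : ℕ} {X : Set (Vec d)} (hX : Convex ℝ X)
    {R : Vec d → ℝ} {gradR : Vec d → Vec d} {μ : ℝ} (hR : IsStronglyConvexMirrorMap X R gradR μ)
    {α : ℝ} (hα : 0 ≤ α) {v x y : Vec d} (hx : x ∈ X) (hy : y ∈ X)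
    (hmin : IsMinOn (fun z => α * inner ℝ z v + bregman R gradR z x) X y) :
    ‖y - x‖ ≤ α * ‖v‖ / μ := by
  -- Comparison with staying at `x`: both `D(x, y)` and `D(y, x)` appear, so the two halves of `μ`
  -- add up.
  have h1 := hR.inner_sub_le hX hy hx hmin
  have h2 := hR.le_bregman hx hy
  have h3 := hR.le_bregman hy hx
  have h4 := abs_le.1 (abs_real_inner_le_norm (y - x) v)
  rw [bregman_self] at h1
  rw [norm_sub_rev x y] at h2
  have h5 : μ * ‖y - x‖ ^ 2 ≤ α * (‖y - x‖ * ‖v‖) := by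
    nlinarith [mul_le_mul_of_nonneg_left h4.1 hα]
  rw [le_div_iff₀ hR.mu_pos]
  rcases (norm_nonneg (y - x)).eq_or_lt with h | h
  · rw [← h, zero_mul]; positivity
  · have : ‖y - x‖ * (‖y - x‖ * μ) ≤ ‖y - x‖ * (α * ‖v‖) := by linarith
    exact le_of_mul_le_mul_left this h

/-! ### The positive part -/

theorem norm_le_norm_of_coord_le {m : ℕ} {v w : Vec m} (hv : ∀ k, 0 ≤ v k)
    (hvw : ∀ k, v k ≤ w k) : ‖v‖ ≤ ‖w‖ := by
  apply le_of_sq_le_sq _ (norm_nonneg _)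
  simp only [EuclideanSpace.real_norm_sq_eq]
  exact Finset.sum_le_sum fun k _ => pow_le_pow_left₀ (hv k) (hvw k) 2

theorem posProj_apply {m : ℕ} (v : Vec m) (k : Fin m) : posProj v k = max (v k) 0 := rfl

theorem posProj_nonneg {m : ℕ} (v : Vec m) (k : Fin m) : 0 ≤ posProj v k := le_max_right _ _

theorem norm_posProj_le {m : ℕ} (v : Vec m) : ‖posProj v‖ ≤ ‖v‖ := by
  apply le_of_sq_le_sq _ (norm_nonneg _)
  simp only [EuclideanSpace.real_norm_sq_eq]
  refine Finset.sum_le_sum fun k _ => sq_le_sq.2 ?_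
  rw [posProj_apply, abs_of_nonneg (le_max_right _ _)]
  exact max_le (le_abs_self _) (abs_nonneg _)

theorem norm_posProj_sub_le {m : ℕ} (v : Vec m) {w : Vec m} (hw : ∀ k, 0 ≤ w k) :
    ‖posProj v - w‖ ≤ ‖v - w‖ := by
  apply le_of_sq_le_sq _ (norm_nonneg _)
  simp only [EuclideanSpace.real_norm_sq_eq]
  refine Finset.sum_le_sum fun k _ => sq_le_sq.2 ?_
  have := abs_max_sub_max_le_abs (v k) (w k) 0
  rwa [max_eq_left (hw k)] at this

theorem inner_eq_sum_mul {m : ℕ} (v w : Vec m) : inner ℝ v w = ∑ k, v k * w k := by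
  simp [PiLp.inner_apply, mul_comm]

theorem inner_le_inner_of_coord_le {m : ℕ} {q v w : Vec m} (hq : ∀ k, 0 ≤ q k)
    (hvw : ∀ k, v k ≤ w k) : inner ℝ q v ≤ inner ℝ q w := by
  rw [inner_eq_sum_mul, inner_eq_sum_mul]
  exact Finset.sum_le_sum fun k _ => mul_le_mul_of_nonneg_left (hvw k) (hq k)

/-- The positive and negative parts are orthogonal. -/
theorem inner_posProj_self {m : ℕ} (v : Vec m) : inner ℝ (posProj v) v = ‖posProj v‖ ^ 2 := by
  rw [inner_eq_sum_mul, EuclideanSpace.real_norm_sq_eq]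
  refine Finset.sum_congr rfl fun k _ => ?_
  rw [posProj_apply]
  rcases le_total (v k) 0 with h | h
  · simp [h]
  · simp [h, sq]

/-- The positive part is subadditive in norm. -/
theorem norm_posProj_le_add {m : ℕ} (v w : Vec m) : ‖posProj v‖ ≤ ‖posProj w‖ + ‖v - w‖ := by
  have h : ‖posProj v‖ ≤ ‖posProj w + posProj (v - w)‖ := by
    refine norm_le_norm_of_coord_le (posProj_nonneg v) fun k => ?_
    have e : (posProj w + posProj (v - w)) k = max (w k) 0 + max (v k - w k) 0 := rfl
    rw [e, posProj_apply]
    have h1 := le_max_left (w k) 0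
    have h2 := le_max_left (v k - w k) 0
    have h3 := le_max_right (w k) 0
    have h4 := le_max_right (v k - w k) 0
    exact max_le (by linarith) (by linarith)
  exact h.trans ((norm_add_le _ _).trans (by gcongr; exact norm_posProj_le _))

/-! ### One primal-dual round -/

theorem IsRegularProblem.f_add_inner_le {n d m : ℕ} {X : Set (Vec d)} {P : OnlineData n d m}
    {dX L F G : ℝ} (hP : IsRegularProblem X P dX L F G) (i : Fin n) {t : ℕ} (ht : 1 ≤ t)
    {x z : Vec d} (hx : x ∈ X) (hz : z ∈ X) :
    P.f i t x + inner ℝ (P.gradf i t x) (z - x) ≤ P.f i t z := by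
  simpa using (hP.convex_f i t ht).add_hasFDerivWithinAt_le
    (hP.hasGradient_f i t ht x hx).hasFDerivWithinAt hx hz

/-- Used twice: at a feasible comparator it makes the linearized constraint nonpositive, and at the
new `y` it limits the growth of the dual variable. -/
theorem IsRegularProblem.linearization_le {n d m : ℕ} {X : Set (Vec d)} {P : OnlineData n d m}
    {dX L F G : ℝ} (hP : IsRegularProblem X P dX L F G) (i : Fin n) {t : ℕ} (ht : 1 ≤ t)
    {x z : Vec d} (hx : x ∈ X) (hz : z ∈ X) (k : Fin m) :
    (P.jacg i t x (z - x) + P.g i t x) k ≤ P.g i t z k := by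
  have hder : HasFDerivWithinAt (fun w => P.g i t w k)
      ((EuclideanSpace.proj k : Vec m →L[ℝ] ℝ).comp (P.jacg i t x)) X x :=
    (EuclideanSpace.proj k : Vec m →L[ℝ] ℝ).hasFDerivAt.comp_hasFDerivWithinAt x
      (hP.hasJacobian_g i t ht x hx)
  have h := (hP.convex_g i t ht k).add_hasFDerivWithinAt_le hder hx hz
  simp only [ContinuousLinearMap.comp_apply, PiLp.proj_apply] at h
  rw [PiLp.add_apply]
  linarith

/-- One projected gradient step on the regularized dual variable. -/
theorem dual_step_le {m : ℕ} {q q' v l : Vec m} {β γ B : ℝ} (hγ : 0 < γ) (hl : ∀ k, 0 ≤ l k)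
    (hB : ‖v - β • q‖ ≤ B) (hq' : q' = posProj (q + γ • (v - β • q))) :
    inner ℝ l v - inner ℝ q v ≤ (‖q - l‖ ^ 2 - ‖q' - l‖ ^ 2) / (2 * γ)
      + β * (inner ℝ l q - ‖q‖ ^ 2) + γ / 2 * B ^ 2 := by
  have h1 : ‖q' - l‖ ^ 2 ≤ ‖(q - l) + γ • (v - β • q)‖ ^ 2 := by
    rw [hq']
    refine pow_le_pow_left₀ (norm_nonneg _) ((norm_posProj_sub_le _ hl).trans_eq ?_) 2
    congr 1; abel
  rw [norm_add_sq_real, norm_smul, inner_smul_right, mul_pow, Real.norm_eq_abs, sq_abs] at h1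
  have h2 : ‖v - β • q‖ ^ 2 ≤ B ^ 2 := pow_le_pow_left₀ (norm_nonneg _) hB 2
  have h3 : inner ℝ (q - l) (v - β • q)
      = inner ℝ q v - inner ℝ l v + β * (inner ℝ l q - ‖q‖ ^ 2) := by
    simp only [inner_sub_left, inner_sub_right, inner_smul_right, real_inner_self_eq_norm_sq]
    ring
  rw [h3] at h1
  have h4 : ‖q' - l‖ ^ 2 ≤ ‖q - l‖ ^ 2
      + 2 * (γ * (inner ℝ q v - inner ℝ l v + β * (inner ℝ l q - ‖q‖ ^ 2))) + γ ^ 2 * B ^ 2 :=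
    h1.trans (by gcongr)
  have h5 : inner ℝ l v - inner ℝ q v - β * (inner ℝ l q - ‖q‖ ^ 2) - γ / 2 * B ^ 2
      ≤ (‖q - l‖ ^ 2 - ‖q' - l‖ ^ 2) / (2 * γ) := by
    rw [le_div_iff₀ (by positivity)]
    linarith
  linarith

/-- One round of the primal-dual algorithm at one node, compared with a feasible action `z` and a
multiplier `l`. -/
theorem IsRegularProblem.primal_dual_step_le {n d m : ℕ} {X : Set (Vec d)} {P : OnlineData n d m}
    {dX L F G : ℝ} (hP : IsRegularProblem X P dX L F G)
    {R : Vec d → ℝ} {gradR : Vec d → Vec d} {μ : ℝ} (hR : IsStronglyConvexMirrorMap X R gradR μ)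
    (i : Fin n) {t : ℕ} (ht : 1 ≤ t) {α β γ : ℝ} (hα : 0 < α) (hβ : 0 ≤ β) (hγ : 0 < γ)
    {x y z : Vec d} (hx : x ∈ X) (hy : y ∈ X) (hz : z ∈ X) (hgz : ∀ k, P.g i t z k ≤ 0)
    {q q' l : Vec m} (hq : ∀ k, 0 ≤ q k) (hl : ∀ k, 0 ≤ l k) (hβq : β * ‖q‖ ≤ F)
    (hmin : IsMinOn (fun w => α * inner ℝ w (primalDirection P i t x q) + bregman R gradR w x) X y)
    (hq' : q' = posProj (q + γ • ((P.jacg i t x (y - x) + P.g i t x) - β • q))) :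
    P.f i t x - P.f i t z + inner ℝ l (P.g i t x)
      ≤ (bregman R gradR z x - bregman R gradR z y) / α
        + ((‖q - l‖ ^ 2 - ‖q' - l‖ ^ 2) / (2 * γ) + β * (inner ℝ l q - ‖q‖ ^ 2))
        + γ / 2 * constB₁ dX F G ^ 2 + α * (G ^ 2 / μ * (1 + ‖l‖ ^ 2)) := by
  set v := P.jacg i t x (y - x) + P.g i t x with hv
  set s := ‖y - x‖ with hs
  have hμ := hR.mu_pos
  have hG := hP.G_pos
  have hjac : ‖P.jacg i t x (y - x)‖ ≤ G * s :=
    ((P.jacg i t x).le_opNorm _).trans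
      (mul_le_mul_of_nonneg_right (hP.bound_jacg i t ht x hx) (norm_nonneg _))
  have hsd : s ≤ dX := hP.diam_le y hy x hx
  have hB : ‖v - β • q‖ ≤ constB₁ dX F G := by
    have h1 : ‖v‖ ≤ G * s + F := (norm_add_le _ _).trans (add_le_add hjac (hP.bound_g i t ht x hx))
    have h2 : ‖β • q‖ ≤ F := by rwa [norm_smul, Real.norm_of_nonneg hβ]
    have h3 := norm_sub_le v (β • q)
    have h4 := mul_le_mul_of_nonneg_left hsd hG.le
    rw [constB₁]; linarith
  have hdual := dual_step_le hγ hl hB hq'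
  have hgrad := hP.f_add_inner_le i ht hx hz
  have hthree := hR.inner_sub_le hP.convex_set hy hz hmin
  have hstrong := hR.le_bregman hy hx
  -- Since `z` is feasible and `q ≥ 0`, linearization at `z` contributes nothing positive. What
  -- remains is exactly the dual part of the primal direction.
  have hqv : inner ℝ q v ≤ inner ℝ q (P.jacg i t x (y - z)) := by
    refine inner_le_inner_of_coord_le hq fun k => ?_
    have h1 := (hP.linearization_le i ht hx hz k).trans (hgz k)
    have h2 : v = (P.jacg i t x (z - x) + P.g i t x) + P.jacg i t x (y - z) := by
      rw [hv]; simp only [map_sub]; abel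
    rw [h2, PiLp.add_apply]
    linarith
  have hfy : inner ℝ (P.gradf i t x) (x - y) ≤ G * s := by
    refine (real_inner_le_norm _ _).trans ?_
    rw [hs, norm_sub_rev y x]
    exact mul_le_mul_of_nonneg_right (hP.bound_gradf i t ht x hx) (norm_nonneg _)
  -- The dual step sees the constraint linearized at `y`; returning to its value at `x` costs `‖l‖ G
  -- s`.
  have hlg : inner ℝ l (P.g i t x) ≤ inner ℝ l v + ‖l‖ * (G * s) := by
    have h1 : inner ℝ l (P.g i t x) = inner ℝ l v - inner ℝ l (P.jacg i t x (y - x)) := by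
      rw [← inner_sub_right, hv]; congr 1; abel
    have h2 := (abs_le.1 (abs_real_inner_le_norm l (P.jacg i t x (y - x)))).1
    have h3 := mul_le_mul_of_nonneg_left hjac (norm_nonneg l)
    linarith
  have hdir : inner ℝ (y - z) (primalDirection P i t x q)
      = inner ℝ (P.gradf i t x) (y - z) + inner ℝ q (P.jacg i t x (y - z)) := by
    rw [primalDirection, inner_add_right, ContinuousLinearMap.adjoint_inner_right,
      real_inner_comm, real_inner_comm q]
  rw [hdir] at hthree
  have hsplit : inner ℝ (P.gradf i t x) (z - x)
      = -(inner ℝ (P.gradf i t x) (x - y)) - inner ℝ (P.gradf i t x) (y - z) := by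
    simp only [inner_sub_right]; ring
  rw [hsplit] at hgrad
  have hthree' : inner ℝ (P.gradf i t x) (y - z) + inner ℝ q (P.jacg i t x (y - z))
      ≤ (bregman R gradR z x - bregman R gradR z y) / α - μ / 2 * s ^ 2 / α := by
    rw [← sub_div, le_div_iff₀ hα]
    linarith
  -- Young's inequality. The strong convexity term `μ s² / (2α)` is split in two halves: `c = 1`
  -- absorbs the loss gradient, `c = ‖l‖` the constraint error.
  have hyoung : ∀ c : ℝ, c * (G * s) ≤ α * (G ^ 2 / μ) * c ^ 2 + μ / 4 * s ^ 2 / α := by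
    intro c
    have h : α * (G ^ 2 / μ) * c ^ 2 + μ / 4 * s ^ 2 / α - c * (G * s)
        = (2 * α * G * c - μ * s) ^ 2 / (4 * α * μ) := by
      field_simp; ring
    have : 0 ≤ (2 * α * G * c - μ * s) ^ 2 / (4 * α * μ) := by positivity
    linarith
  have hy1 := hyoung 1
  have hy2 := hyoung ‖l‖
  have e : μ / 2 * s ^ 2 / α = μ / 4 * s ^ 2 / α + μ / 4 * s ^ 2 / α := by ring
  linarith

/-! ### Summation over time -/

/-- Summation by parts for the dual variable. -/
theorem dual_telescope_le {m : ℕ} {b : ℝ} (hb0 : 0 < b) (hb1 : b < 1) {q : ℕ → Vec m}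
    (hq : q 1 = 0) (l : Vec m) (T : ℕ) :
    ∑ t ∈ Finset.Icc 1 T, ((‖q t - l‖ ^ 2 - ‖q (t + 1) - l‖ ^ 2)
          / (2 * (1 / ((t + 1 : ℕ) : ℝ) ^ (1 - b)))
        + 1 / ((t + 1 : ℕ) : ℝ) ^ b * (inner ℝ l (q t) - ‖q t‖ ^ 2))
      ≤ ‖l‖ ^ 2 / 2 * (1 + ∑ t ∈ Finset.Icc 1 T, 1 / ((t + 1 : ℕ) : ℝ) ^ b) := by
  -- The boundary term is kept so that the induction closes. The 1 on the right is the initial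
  -- weight, with `q 1 = 0`.
  suffices h : ∑ t ∈ Finset.Icc 1 T, ((‖q t - l‖ ^ 2 - ‖q (t + 1) - l‖ ^ 2)
          / (2 * (1 / ((t + 1 : ℕ) : ℝ) ^ (1 - b)))
        + 1 / ((t + 1 : ℕ) : ℝ) ^ b * (inner ℝ l (q t) - ‖q t‖ ^ 2))
        + ((T + 1 : ℕ) : ℝ) ^ (1 - b) / 2 * ‖q (T + 1) - l‖ ^ 2
      ≤ ‖l‖ ^ 2 / 2 * (1 + ∑ t ∈ Finset.Icc 1 T, 1 / ((t + 1 : ℕ) : ℝ) ^ b) by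
    have : 0 ≤ ((T + 1 : ℕ) : ℝ) ^ (1 - b) / 2 * ‖q (T + 1) - l‖ ^ 2 := by positivity
    linarith
  induction T with
  | zero => simp [hq]; linarith
  | succ T ih =>
    rw [Finset.sum_Icc_succ_top (by omega), Finset.sum_Icc_succ_top (by omega)]
    have hδ := rpow_succ_sub_le hb0 (T + 1) (by omega)
    have hδ0 : ((T + 1 : ℕ) : ℝ) ^ (1 - b) ≤ ((T + 1 + 1 : ℕ) : ℝ) ^ (1 - b) :=
      Real.rpow_le_rpow (by positivity) (by push_cast; linarith) (by linarith)
    set β := 1 / ((T + 1 + 1 : ℕ) : ℝ) ^ b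
    set A := ((T + 1 + 1 : ℕ) : ℝ) ^ (1 - b)
    set A' := ((T + 1 : ℕ) : ℝ) ^ (1 - b)
    have e : ∀ r : ℝ, r / (2 * (1 / A)) = A / 2 * r := by intro r; field_simp
    rw [e]
    have hin : inner ℝ l (q (T + 1)) ≤ (‖q (T + 1)‖ ^ 2 + ‖l‖ ^ 2) / 2 := by
      have := real_inner_le_norm l (q (T + 1))
      nlinarith [sq_nonneg (‖q (T + 1)‖ - ‖l‖)]
    have hn : ‖q (T + 1) - l‖ ^ 2
        = ‖q (T + 1)‖ ^ 2 - 2 * inner ℝ l (q (T + 1)) + ‖l‖ ^ 2 := by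
      rw [norm_sub_sq_real, real_inner_comm]
    -- With `A - A' ≤ β`, the left side is at most `β / 2 * (‖l‖² - ‖q‖²)`.
    have key : (A - A') / 2 * ‖q (T + 1) - l‖ ^ 2 + β * (inner ℝ l (q (T + 1)) - ‖q (T + 1)‖ ^ 2)
        ≤ ‖l‖ ^ 2 / 2 * β := by
      rw [hn]
      have hp := mul_le_mul_of_nonneg_left hin (sub_nonneg.2 hδ)
      have hβ : 0 ≤ β := by positivity
      nlinarith [mul_nonneg hβ (sq_nonneg ‖q (T + 1)‖)]
    linarith

/-- Summation by parts with non-decreasing weights. -/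
theorem weighted_telescope_le {Φ A : ℕ → ℝ} {M : ℝ} (hA : Monotone A) (hA0 : 0 ≤ A 1)
    (hΦ0 : ∀ t, 1 ≤ t → 0 ≤ Φ t) (hΦ : ∀ t, 1 ≤ t → Φ t ≤ M) (T : ℕ) :
    ∑ t ∈ Finset.Icc 1 T, A (t + 1) * (Φ t - Φ (t + 1)) ≤ M * A (T + 1) := by
  suffices h : ∑ t ∈ Finset.Icc 1 T, A (t + 1) * (Φ t - Φ (t + 1)) + A (T + 1) * Φ (T + 1)
      ≤ M * A (T + 1) by
    have : 0 ≤ A (T + 1) * Φ (T + 1) :=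
      mul_nonneg (hA0.trans (hA (by omega))) (hΦ0 _ (by omega))
    linarith
  induction T with
  | zero => simpa [mul_comm] using mul_le_mul_of_nonneg_left (hΦ 1 le_rfl) hA0
  | succ T ih =>
    rw [Finset.sum_Icc_succ_top (by omega)]
    have h1 : A (T + 1) ≤ A (T + 1 + 1) := hA (by omega)
    nlinarith [mul_le_mul_of_nonneg_left (hΦ (T + 1) (by omega)) (sub_nonneg.2 h1)]

/-- The sum of a perturbed geometrically contracting sequence. -/
theorem sum_contracting_le {V ε : ℕ → ℝ} {σ : ℝ} (hσ : 0 ≤ σ) (hV : ∀ t, 1 ≤ t → 0 ≤ V t)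
    (hV1 : V 1 = 0) (hstep : ∀ t, 1 ≤ t → V (t + 1) ≤ σ * (V t + ε t)) (T : ℕ) :
    (1 - σ) * ∑ t ∈ Finset.Icc 1 (T + 1), V t ≤ σ * ∑ t ∈ Finset.Icc 1 T, ε t := by
  suffices h : (1 - σ) * ∑ t ∈ Finset.Icc 1 (T + 1), V t + σ * V (T + 1)
      ≤ σ * ∑ t ∈ Finset.Icc 1 T, ε t by
    have := mul_nonneg hσ (hV (T + 1) (by omega))
    linarith
  induction T with
  | zero => simp [hV1]
  | succ T ih =>
    rw [Finset.sum_Icc_succ_top (b := T + 1) (by omega),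
      Finset.sum_Icc_succ_top (b := T) (f := ε) (by omega)]
    have := hstep (T + 1) (by omega)
    linarith

/-! ### Estimates along a run of the algorithm -/

namespace IsAlgorithmRun

variable {n d m : ℕ} {X : Set (Vec d)} {P : OnlineData n d m} {W : Matrix (Fin n) (Fin n) ℝ}
  {R : Vec d → ℝ} {gradR : Vec d → Vec d} {α β γ : ℕ → ℝ} {x y : Fin n → ℕ → Vec d}
  {q : Fin n → ℕ → Vec m} {dX L F G μ a b : ℝ}

theorem x_mem (hrun : IsAlgorithmRun X P W R gradR α β γ x y q) (hX : Convex ℝ X)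
    (hW : W ∈ doublyStochastic ℝ (Fin n)) (i : Fin n) (t : ℕ) : x i t ∈ X := by
  cases t with
  | zero => rw [hrun.x_zero]; exact hrun.zero_mem
  | succ t =>
    rw [hrun.consensus]
    exact hX.sum_mem (fun j _ => nonneg_of_mem_doublyStochastic hW)
      (sum_row_of_mem_doublyStochastic hW i) (fun j _ => hrun.primal_mem j t)

theorem q_nonneg (hrun : IsAlgorithmRun X P W R gradR α β γ x y q) (i : Fin n) (t : ℕ)
    (k : Fin m) : 0 ≤ q i t k := by
  cases t with
  | zero => rw [hrun.q_zero]; simp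
  | succ t => rw [hrun.dual]; exact posProj_nonneg _ k

/-- The data of time 0 vanish, so the first mirror step has length zero. All nodes thus agree at
time 1, where the regularity assumptions begin. -/
theorem y_one (hrun : IsAlgorithmRun X P W R gradR α β γ x y q) (hX : Convex ℝ X)
    (hR : IsStronglyConvexMirrorMap X R gradR μ) (hα : 0 ≤ α 1) (i : Fin n) : y i 1 = 0 := by
  have hx : x i 0 ∈ X := by rw [hrun.x_zero]; exact hrun.zero_mem
  have h := hR.norm_step_le hX hα hx (hrun.primal_mem i 0) (hrun.primal_min i 0)
  have hdir : primalDirection P i 0 (x i 0) (q i 0) = 0 := by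
    simp [primalDirection, (hrun.f_zero i _ hx).2, (hrun.g_zero i _ hx).2]
  rw [hdir, hrun.x_zero] at h
  simpa using h

theorem x_one (hrun : IsAlgorithmRun X P W R gradR α β γ x y q) (hX : Convex ℝ X)
    (hR : IsStronglyConvexMirrorMap X R gradR μ) (hα : 0 ≤ α 1) (i : Fin n) : x i 1 = 0 := by
  have h := hrun.consensus i 0
  rw [zero_add] at h
  rw [h]
  exact Finset.sum_eq_zero fun j _ => by rw [hrun.y_one hX hR hα j, smul_zero]

theorem q_one (hrun : IsAlgorithmRun X P W R gradR α β γ x y q) (i : Fin n) : q i 1 = 0 := by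
  have hx : x i 0 ∈ X := by rw [hrun.x_zero]; exact hrun.zero_mem
  have h := hrun.dual i 0
  rw [(hrun.g_zero i _ hx).1, (hrun.g_zero i _ hx).2, hrun.q_zero] at h
  rw [zero_add] at h
  rw [h]
  ext k
  simp [posProj_apply]

/-- The dual variables grow at most like the inverse of the regularization. -/
theorem norm_q_le (hrun : IsAlgorithmRun X P W R gradR α (fun t => 1 / (t : ℝ) ^ b)
      (fun t => 1 / (t : ℝ) ^ (1 - b)) x y q)
    (hP : IsRegularProblem X P dX L F G) (hW : W ∈ doublyStochastic ℝ (Fin n)) (hb : 0 < b)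
    (i : Fin n) {t : ℕ} (ht : 1 ≤ t) : ‖q i t‖ ≤ F * (t : ℝ) ^ b := by
  induction t, ht using Nat.le_induction with
  | base => rw [hrun.q_one]; simpa using hP.F_pos.le
  | succ t ht ih =>
    have hu : (0 : ℝ) < ((t + 1 : ℕ) : ℝ) := by positivity
    have hstep := hrun.dual i t
    have hx := hrun.x_mem hP.convex_set hW i t
    have hy := hrun.primal_mem i t
    beta_reduce at hstep
    set u : ℝ := ((t + 1 : ℕ) : ℝ) with hu_def
    -- Because `γβ = 1/u` and `γ = u^b / u`, the new dual variable lies coordinatewise below a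
    -- convex combination of the old one and `u^b` times the positive part of `g` at `y`; the bound
    -- `F u^b` is therefore preserved.
    have hγβ : 1 / u ^ (1 - b) * (1 / u ^ b) = 1 / u := by
      rw [one_div_mul_one_div, ← Real.rpow_add hu]; simp
    have hγ : 1 / u ^ (1 - b) = u ^ b / u := by
      rw [Real.rpow_sub hu, Real.rpow_one]; field_simp
    have hγ0 : 0 < 1 / u ^ (1 - b) := by positivity
    have h1u : 0 ≤ 1 - 1 / u := by
      rw [sub_nonneg, div_le_one hu, hu_def]; push_cast; linarith [Nat.cast_nonneg (α := ℝ) t]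
    have hle : ‖q i (t + 1)‖ ≤ ‖(1 - 1 / u) • q i t
        + (1 / u ^ (1 - b)) • posProj (P.g i t (y i (t + 1)))‖ := by
      refine norm_le_norm_of_coord_le (hrun.q_nonneg i (t + 1)) fun k => ?_
      have hlin := hP.linearization_le i ht hx hy k
      rw [hstep, posProj_apply]
      simp only [PiLp.add_apply, PiLp.smul_apply, PiLp.sub_apply, smul_eq_mul] at hlin ⊢
      rw [posProj_apply]
      have h1 := mul_le_mul_of_nonneg_left
        (hlin.trans (le_max_left (P.g i t (y i (t + 1)) k) 0)) hγ0.le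
      have h2 := mul_nonneg h1u (hrun.q_nonneg i t k)
      have h3 := mul_nonneg hγ0.le (le_max_right (P.g i t (y i (t + 1)) k) 0)
      refine max_le ?_ (by linarith)
      rw [← hγβ]
      linarith
    have hg : ‖posProj (P.g i t (y i (t + 1)))‖ ≤ F :=
      (norm_posProj_le _).trans (hP.bound_g i t ht _ hy)
    have htu : (t : ℝ) ^ b ≤ u ^ b :=
      Real.rpow_le_rpow (by positivity) (by rw [hu_def]; push_cast; linarith) hb.le
    calc ‖q i (t + 1)‖ ≤ (1 - 1 / u) * ‖q i t‖
          + 1 / u ^ (1 - b) * ‖posProj (P.g i t (y i (t + 1)))‖ := by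
          refine hle.trans ((norm_add_le _ _).trans_eq ?_)
          rw [norm_smul, norm_smul, Real.norm_of_nonneg h1u, Real.norm_of_nonneg hγ0.le]
      _ ≤ (1 - 1 / u) * (F * u ^ b) + 1 / u ^ (1 - b) * F := by
          gcongr
          exact ih.trans (mul_le_mul_of_nonneg_left htu hP.F_pos.le)
      _ = F * u ^ b := by rw [hγ]; field_simp; ring

theorem norm_primalDirection_le (hP : IsRegularProblem X P dX L F G) (i : Fin n) {t : ℕ}
    (ht : 1 ≤ t) {z : Vec d} (hz : z ∈ X) (w : Vec m) :
    ‖primalDirection P i t z w‖ ≤ G * (1 + ‖w‖) := by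
  have h1 := hP.bound_gradf i t ht z hz
  have h2 : ‖ContinuousLinearMap.adjoint (P.jacg i t z) w‖ ≤ G * ‖w‖ := by
    refine (ContinuousLinearMap.le_opNorm _ _).trans ?_
    rw [LinearIsometryEquiv.norm_map]
    exact mul_le_mul_of_nonneg_right (hP.bound_jacg i t ht z hz) (norm_nonneg _)
  have h3 := norm_add_le (P.gradf i t z) (ContinuousLinearMap.adjoint (P.jacg i t z) w)
  rw [primalDirection]
  linarith

/-- The accumulated disagreement between the nodes. -/
theorem sum_disagreement_le (hrun : IsAlgorithmRun X P W R gradR (fun t => 1 / (t : ℝ) ^ a)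
      (fun t => 1 / (t : ℝ) ^ b) (fun t => 1 / (t : ℝ) ^ (1 - b)) x y q)
    (hn : 0 < n) (hP : IsRegularProblem X P dX L F G) (hsymm : W.IsSymm)
    (hW : W ∈ doublyStochastic ℝ (Fin n)) (hσ : secondEigenvalueModulus W < 1)
    (hR : IsStronglyConvexMirrorMap X R gradR μ) (hb : 0 < b) (ha0 : 0 < a) (ha : a < 1)
    (T : ℕ) (hT : 1 ≤ T) :
    2 * L * ∑ t ∈ Finset.Icc 1 T, disagreement (fun i => x i t)
      ≤ constR n (secondEigenvalueModulus W) L F G μ a * (T : ℝ) ^ (1 - a + b) := by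
  have hμ := hR.mu_pos
  have hG := hP.G_pos
  have hF := hP.F_pos
  set σ := secondEigenvalueModulus W
  have hσ0 : 0 ≤ σ := secondEigenvalueModulus_nonneg W
  set c := G * (1 + F) / μ with hc
  -- An upper bound for `√n` times the length of a mirror step, with `1 + ‖q_t‖ ≤ (1 + F) t^b`.
  set ε : ℕ → ℝ := fun t => Real.sqrt n * (c * ((t : ℝ) ^ b * (1 / ((t + 1 : ℕ) : ℝ) ^ a)))
    with hε
  have hstep : ∀ t, 1 ≤ t → disagreement (fun i => x i (t + 1))
      ≤ σ * (disagreement (fun i => x i t) + ε t) := by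
    intro t ht
    have hx1 : (fun i => x i (t + 1)) = fun i => ∑ j, W i j • y j (t + 1) :=
      funext fun i => hrun.consensus i t
    rw [hx1]
    refine (disagreement_mix_le hn hsymm hW hσ _).trans (mul_le_mul_of_nonneg_left ?_ hσ0)
    refine disagreement_le_add hn _ _ (by positivity) fun i => ?_
    have hxi := hrun.x_mem hP.convex_set hW i t
    have h1 := hR.norm_step_le hP.convex_set (by positivity) hxi (hrun.primal_mem i t)
      (hrun.primal_min i t)
    refine h1.trans ?_
    have h2 := norm_primalDirection_le hP i ht hxi (q i t)
    have h3 := hrun.norm_q_le hP hW hb i ht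
    have h4 : (1 : ℝ) ≤ (t : ℝ) ^ b := Real.one_le_rpow (by exact_mod_cast ht) hb.le
    have h5 : ‖primalDirection P i t (x i t) (q i t)‖ ≤ G * (1 + F) * (t : ℝ) ^ b := by
      refine h2.trans ?_
      have : 1 + ‖q i t‖ ≤ (1 + F) * (t : ℝ) ^ b := by linarith
      calc G * (1 + ‖q i t‖) ≤ G * ((1 + F) * (t : ℝ) ^ b) := by gcongr
        _ = _ := by ring
    calc 1 / ((t + 1 : ℕ) : ℝ) ^ a * ‖primalDirection P i t (x i t) (q i t)‖ / μ
        ≤ 1 / ((t + 1 : ℕ) : ℝ) ^ a * (G * (1 + F) * (t : ℝ) ^ b) / μ := by gcongr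
      _ = c * ((t : ℝ) ^ b * (1 / ((t + 1 : ℕ) : ℝ) ^ a)) := by rw [hc]; ring
  have hV1 : disagreement (fun i => x i 1) = 0 :=
    disagreement_eq_zero _ fun i => hrun.x_one hP.convex_set hR (by simp) i
  have hsum := sum_contracting_le (V := fun t => disagreement (fun i => x i t)) hσ0
    (fun t _ => disagreement_nonneg _) hV1 hstep T
  have hT0 : (0 : ℝ) < T := by exact_mod_cast hT
  have hεsum : ∑ t ∈ Finset.Icc 1 T, ε t
      ≤ Real.sqrt n * c * ((T : ℝ) ^ (1 - a + b) / (1 - a)) := by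
    have h1 : ∀ t ∈ Finset.Icc 1 T, ε t
        ≤ Real.sqrt n * c * (T : ℝ) ^ b * (1 / ((t + 1 : ℕ) : ℝ) ^ a) := by
      intro t ht
      have h2 : (t : ℝ) ^ b ≤ (T : ℝ) ^ b :=
        Real.rpow_le_rpow (by positivity) (by exact_mod_cast (Finset.mem_Icc.1 ht).2) hb.le
      calc ε t ≤ Real.sqrt n * (c * ((T : ℝ) ^ b * (1 / ((t + 1 : ℕ) : ℝ) ^ a))) := by
            rw [hε]; dsimp only; gcongr
        _ = _ := by ring
    refine (Finset.sum_le_sum h1).trans ?_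
    rw [← Finset.mul_sum, Real.rpow_add hT0]
    calc _ ≤ Real.sqrt n * c * (T : ℝ) ^ b * ((T : ℝ) ^ (1 - a) / (1 - a)) := by
          gcongr; exact sum_one_div_rpow_succ_le ha0 ha T
      _ = _ := by ring
  have hmono : ∑ t ∈ Finset.Icc 1 T, disagreement (fun i => x i t)
      ≤ ∑ t ∈ Finset.Icc 1 (T + 1), disagreement (fun i => x i t) := by
    rw [Finset.sum_Icc_succ_top (by omega)]
    linarith [disagreement_nonneg (fun i => x i (T + 1))]
  have h1σ : 0 < 1 - σ := by linarith
  have h1a : 0 < 1 - a := by linarith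
  have hS : ∑ t ∈ Finset.Icc 1 T, disagreement (fun i => x i t)
      ≤ σ * (Real.sqrt n * c * ((T : ℝ) ^ (1 - a + b) / (1 - a))) / (1 - σ) := by
    rw [le_div_iff₀ h1σ]
    have h1 := mul_le_mul_of_nonneg_left hεsum hσ0
    have h2 := mul_le_mul_of_nonneg_left hmono h1σ.le
    linarith
  have hL := hP.L_nonneg
  calc 2 * L * ∑ t ∈ Finset.Icc 1 T, disagreement (fun i => x i t)
      ≤ 2 * L * (σ * (Real.sqrt n * c * ((T : ℝ) ^ (1 - a + b) / (1 - a))) / (1 - σ)) := by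
        gcongr
    _ = constR n σ L F G μ a * (T : ℝ) ^ (1 - a + b) := by
        rw [constR, hc]; field_simp

/-- The Bregman terms of all nodes, summed by parts over time. -/
theorem sum_bregman_le (hrun : IsAlgorithmRun X P W R gradR α β γ x y q) (hX : Convex ℝ X)
    (hdiam : ∀ u ∈ X, ∀ v ∈ X, ‖u - v‖ ≤ dX) (hW : W ∈ doublyStochastic ℝ (Fin n))
    (hR : IsStronglyConvexMirrorMap X R gradR μ) {K : ℝ} (hD : IsRegularBregman X R gradR K)
    {xs : ℕ → Vec d} (hxs : ∀ t, 1 ≤ t → xs t ∈ X) {A : ℕ → ℝ} (hA : Monotone A)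
    (hA0 : 0 ≤ A 1) (T : ℕ) :
    ∑ i, ∑ t ∈ Finset.Icc 1 T,
        A (t + 1) * (bregman R gradR (xs t) (x i t) - bregman R gradR (xs t) (y i (t + 1)))
      ≤ n * (K * dX * A (T + 1) + K * A (T + 1) * pathLength xs T) := by
  have hx := hrun.x_mem hX hW
  have hnonneg : ∀ u ∈ X, ∀ v ∈ X, 0 ≤ bregman R gradR u v := fun u hu v hv =>
    le_trans (by have := hR.mu_pos; positivity) (hR.le_bregman hu hv)
  -- Lipschitz continuity in the first argument, started from `D(v, v) = 0`.
  have hle : ∀ u ∈ X, ∀ v ∈ X, bregman R gradR u v ≤ K * dX := by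
    intro u hu v hv
    have h1 := (abs_le.1 (hD.lipschitz u hu v hv v hv)).2
    rw [bregman_self, sub_zero] at h1
    exact h1.trans (mul_le_mul_of_nonneg_left (hdiam u hu v hv) hD.K_nonneg)
  set Φ : ℕ → ℝ := fun t => ∑ i, bregman R gradR (xs t) (x i t) with hΦ
  -- Jensen's inequality in the second argument with row weights; unit column sums then restore the
  -- plain sum over nodes.
  have hmix : ∀ t, 1 ≤ t → ∑ i, bregman R gradR (xs t) (x i (t + 1))
      ≤ ∑ i, bregman R gradR (xs t) (y i (t + 1)) := by
    intro t ht
    calc ∑ i, bregman R gradR (xs t) (x i (t + 1))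
        ≤ ∑ i, ∑ j, W i j * bregman R gradR (xs t) (y j (t + 1)) := by
          refine Finset.sum_le_sum fun i _ => ?_
          rw [hrun.consensus]
          exact (hD.separately_convex _ (hxs t ht)).map_sum_le
            (fun j _ => nonneg_of_mem_doublyStochastic hW)
            (sum_row_of_mem_doublyStochastic hW i) (fun j _ => hrun.primal_mem j t)
      _ = ∑ i, bregman R gradR (xs t) (y i (t + 1)) := by
          rw [Finset.sum_comm]
          refine Finset.sum_congr rfl fun j _ => ?_
          rw [← Finset.sum_mul, sum_col_of_mem_doublyStochastic hW, one_mul]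
  have hdrift : ∀ t, 1 ≤ t → Φ (t + 1) ≤ ∑ i, bregman R gradR (xs t) (x i (t + 1))
      + n * (K * ‖xs (t + 1) - xs t‖) := by
    intro t ht
    have h : ∀ i, bregman R gradR (xs (t + 1)) (x i (t + 1))
        ≤ bregman R gradR (xs t) (x i (t + 1)) + K * ‖xs (t + 1) - xs t‖ := fun i => by
      linarith [(abs_le.1 (hD.lipschitz _ (hxs (t + 1) (by omega)) _ (hx i (t + 1)) _
        (hxs t ht))).2]
    refine (Finset.sum_le_sum fun i _ => h i).trans_eq ?_
    rw [Finset.sum_add_distrib]; simp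
  have hpos : ∀ t, 0 ≤ A (t + 1) := fun t => hA0.trans (hA (by omega))
  have htel := weighted_telescope_le (Φ := Φ) (M := n * (K * dX)) hA hA0
    (fun t ht => Finset.sum_nonneg fun i _ => hnonneg _ (hxs t ht) _ (hx i t))
    (fun t ht => by
      refine (Finset.sum_le_sum fun i _ => hle _ (hxs t ht) _ (hx i t)).trans_eq ?_
      simp) T
  rw [Finset.sum_comm]
  calc ∑ t ∈ Finset.Icc 1 T, ∑ i,
        A (t + 1) * (bregman R gradR (xs t) (x i t) - bregman R gradR (xs t) (y i (t + 1)))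
      ≤ ∑ t ∈ Finset.Icc 1 T, (A (t + 1) * (Φ t - Φ (t + 1))
          + n * K * A (T + 1) * ‖xs (t + 1) - xs t‖) := by
        refine Finset.sum_le_sum fun t ht => ?_
        have ht1 := (Finset.mem_Icc.1 ht).1
        have htT := (Finset.mem_Icc.1 ht).2
        rw [← Finset.mul_sum, Finset.sum_sub_distrib]
        have h1 := hmix t ht1
        have h2 := hdrift t ht1
        have h3 : A (t + 1) * (∑ i, bregman R gradR (xs t) (x i t)
              - ∑ i, bregman R gradR (xs t) (y i (t + 1)))
            ≤ A (t + 1) * (Φ t - Φ (t + 1) + n * (K * ‖xs (t + 1) - xs t‖)) :=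
          mul_le_mul_of_nonneg_left (by simp only [hΦ] at h2 ⊢; linarith) (hpos t)
        have h4 : A (t + 1) * (n * (K * ‖xs (t + 1) - xs t‖))
            ≤ A (T + 1) * (n * (K * ‖xs (t + 1) - xs t‖)) := by
          have hK := hD.K_nonneg
          exact mul_le_mul_of_nonneg_right (hA (by omega)) (by positivity)
        linarith
    _ ≤ n * (K * dX * A (T + 1) + K * A (T + 1) * pathLength xs T) := by
        rw [Finset.sum_add_distrib, ← Finset.mul_sum, pathLength]
        linarith

/-- The regret of the local losses, together with the constraint values weighted by arbitrary
multipliers `l`. -/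
theorem sum_lagrangian_le (hrun : IsAlgorithmRun X P W R gradR (fun t => 1 / (t : ℝ) ^ a)
      (fun t => 1 / (t : ℝ) ^ b) (fun t => 1 / (t : ℝ) ^ (1 - b)) x y q)
    (hP : IsRegularProblem X P dX L F G)
    (hW : W ∈ doublyStochastic ℝ (Fin n)) (hR : IsStronglyConvexMirrorMap X R gradR μ)
    {K : ℝ} (hD : IsRegularBregman X R gradR K) (hb : 0 < b) (hb1 : b < 1) (ha0 : 0 < a)
    (ha : a < 1) {xs : ℕ → Vec d} (hxs : IsComparator X P xs) {l : Fin n → Vec m}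
    (hl : ∀ i k, 0 ≤ l i k) (T : ℕ) (hT : 1 ≤ T) :
    ∑ i, (∑ t ∈ Finset.Icc 1 T, (P.f i t (x i t) - P.f i t (xs t))
        + inner ℝ (l i) (∑ t ∈ Finset.Icc 1 T, P.g i t (x i t))
        - ‖l i‖ ^ 2 / 2 * (1 + (T : ℝ) ^ (1 - b) / (1 - b)
            + 2 * G ^ 2 / (μ * (1 - a)) * (T : ℝ) ^ (1 - a)))
      ≤ n * (constB₁ dX F G ^ 2 / (2 * b) * (T : ℝ) ^ b
          + G ^ 2 / (μ * (1 - a)) * (T : ℝ) ^ (1 - a)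
          + 2 * K * dX * (T : ℝ) ^ a + 2 * K * (T : ℝ) ^ a * pathLength xs T) := by
  have hμ := hR.mu_pos
  have hx := hrun.x_mem hP.convex_set hW
  have hxsX : ∀ t, 1 ≤ t → xs t ∈ X := fun t ht => (hxs t ht).1.1
  set A : ℕ → ℝ := fun t => (t : ℝ) ^ a with hA_def
  have hA : Monotone A := fun s t hst =>
    Real.rpow_le_rpow (by positivity) (by exact_mod_cast hst) ha0.le
  have hbreg := hrun.sum_bregman_le hP.convex_set hP.diam_le hW hR hD hxsX hA (by simp [A]) T
  have hAT : A (T + 1) ≤ 2 * (T : ℝ) ^ a := rpow_succ_le_two_mul ha0.le ha.le T hT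
  have hC : 0 ≤ pathLength xs T := Finset.sum_nonneg fun t _ => norm_nonneg _
  have hK := hD.K_nonneg
  have hdX := hP.diam_pos
  have hsα := sum_one_div_rpow_succ_le ha0 ha T
  have hsβ := sum_one_div_rpow_succ_le hb hb1 T
  -- The exponent `1 - b` gives `T^b / b`, hence the `1 / (2b)` in the constants.
  have hsγ := sum_one_div_rpow_succ_le (p := 1 - b) (by linarith) (by linarith) T
  rw [sub_sub_cancel] at hsγ
  set sα := ∑ t ∈ Finset.Icc 1 T, 1 / ((t + 1 : ℕ) : ℝ) ^ a with hsα_def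
  set sβ := ∑ t ∈ Finset.Icc 1 T, 1 / ((t + 1 : ℕ) : ℝ) ^ b with hsβ_def
  set sγ := ∑ t ∈ Finset.Icc 1 T, 1 / ((t + 1 : ℕ) : ℝ) ^ (1 - b) with hsγ_def
  have hnode : ∀ i, ∑ t ∈ Finset.Icc 1 T, (P.f i t (x i t) - P.f i t (xs t))
        + inner ℝ (l i) (∑ t ∈ Finset.Icc 1 T, P.g i t (x i t))
      ≤ ∑ t ∈ Finset.Icc 1 T,
          A (t + 1) * (bregman R gradR (xs t) (x i t) - bregman R gradR (xs t) (y i (t + 1)))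
        + ‖l i‖ ^ 2 / 2 * (1 + sβ) + constB₁ dX F G ^ 2 / 2 * sγ
        + G ^ 2 / μ * (1 + ‖l i‖ ^ 2) * sα := by
    intro i
    have hstep : ∀ t ∈ Finset.Icc 1 T,
        P.f i t (x i t) - P.f i t (xs t) + inner ℝ (l i) (P.g i t (x i t))
        ≤ A (t + 1) * (bregman R gradR (xs t) (x i t) - bregman R gradR (xs t) (y i (t + 1)))
          + ((‖q i t - l i‖ ^ 2 - ‖q i (t + 1) - l i‖ ^ 2)
              / (2 * (1 / ((t + 1 : ℕ) : ℝ) ^ (1 - b)))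
            + 1 / ((t + 1 : ℕ) : ℝ) ^ b * (inner ℝ (l i) (q i t) - ‖q i t‖ ^ 2))
          + constB₁ dX F G ^ 2 / 2 * (1 / ((t + 1 : ℕ) : ℝ) ^ (1 - b))
          + G ^ 2 / μ * (1 + ‖l i‖ ^ 2) * (1 / ((t + 1 : ℕ) : ℝ) ^ a) := by
      intro t ht
      have ht1 := (Finset.mem_Icc.1 ht).1
      have hu : (0 : ℝ) < ((t + 1 : ℕ) : ℝ) := by positivity
      have hβq : 1 / ((t + 1 : ℕ) : ℝ) ^ b * ‖q i t‖ ≤ F := by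
        have h1 := hrun.norm_q_le hP hW hb i ht1
        have h2 : (t : ℝ) ^ b ≤ ((t + 1 : ℕ) : ℝ) ^ b :=
          Real.rpow_le_rpow (by positivity) (by push_cast; linarith) hb.le
        rw [one_div_mul_eq_div, div_le_iff₀ (by positivity)]
        exact h1.trans (mul_le_mul_of_nonneg_left h2 hP.F_pos.le)
      have h := hP.primal_dual_step_le hR i ht1 (by positivity) (by positivity) (by positivity)
        (hx i t) (hrun.primal_mem i t) (hxsX t ht1) ((hxs t ht1).1.2 i) (hrun.q_nonneg i t)
        (hl i) hβq (hrun.primal_min i t) (hrun.dual i t)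
      refine h.trans_eq ?_
      simp only [hA_def]
      rw [div_div_eq_mul_div, div_one]
      ring
    have hdual := dual_telescope_le hb hb1 (hrun.q_one i) (l i) T
    have hsum := Finset.sum_le_sum hstep
    rw [hsα_def, hsβ_def, hsγ_def, inner_sum]
    simp only [Finset.sum_add_distrib, ← Finset.mul_sum] at hsum hdual
    linarith
  have h1a : 0 < 1 - a := by linarith
  have hG2 : 0 ≤ G ^ 2 / μ := by positivity
  have hnode' : ∀ i, ∑ t ∈ Finset.Icc 1 T, (P.f i t (x i t) - P.f i t (xs t))
        + inner ℝ (l i) (∑ t ∈ Finset.Icc 1 T, P.g i t (x i t))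
        - ‖l i‖ ^ 2 / 2 * (1 + (T : ℝ) ^ (1 - b) / (1 - b)
            + 2 * G ^ 2 / (μ * (1 - a)) * (T : ℝ) ^ (1 - a))
      ≤ ∑ t ∈ Finset.Icc 1 T,
          A (t + 1) * (bregman R gradR (xs t) (x i t) - bregman R gradR (xs t) (y i (t + 1)))
        + (constB₁ dX F G ^ 2 / (2 * b) * (T : ℝ) ^ b
          + G ^ 2 / (μ * (1 - a)) * (T : ℝ) ^ (1 - a)) := by
    intro i
    have h1 : ‖l i‖ ^ 2 / 2 * sβ ≤ ‖l i‖ ^ 2 / 2 * ((T : ℝ) ^ (1 - b) / (1 - b)) := by gcongr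
    have h2 : constB₁ dX F G ^ 2 / 2 * sγ ≤ constB₁ dX F G ^ 2 / (2 * b) * (T : ℝ) ^ b := by
      calc _ ≤ constB₁ dX F G ^ 2 / 2 * ((T : ℝ) ^ b / b) := by gcongr
        _ = _ := by field_simp
    have h3 : G ^ 2 / μ * (1 + ‖l i‖ ^ 2) * sα
        ≤ G ^ 2 / (μ * (1 - a)) * (T : ℝ) ^ (1 - a)
          + ‖l i‖ ^ 2 / 2 * (2 * G ^ 2 / (μ * (1 - a)) * (T : ℝ) ^ (1 - a)) := by
      calc _ ≤ G ^ 2 / μ * (1 + ‖l i‖ ^ 2) * ((T : ℝ) ^ (1 - a) / (1 - a)) := by gcongr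
        _ = _ := by field_simp
    linarith [hnode i]
  refine (Finset.sum_le_sum fun i _ => hnode' i).trans ?_
  rw [Finset.sum_add_distrib, Finset.sum_const, Finset.card_fin, nsmul_eq_mul]
  have hfin : n * (K * dX * A (T + 1) + K * A (T + 1) * pathLength xs T)
      ≤ n * (K * dX * (2 * (T : ℝ) ^ a) + K * (2 * (T : ℝ) ^ a) * pathLength xs T) := by
    gcongr
  linarith

end IsAlgorithmRun

/-! ### From local quantities to network averages -/

/-- Evaluating the loss of node `j` at `x_i` instead of `x_j` costs `L ‖x_i - x_j‖`, at most `2L`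
times the disagreement. -/
theorem IsRegularProblem.dynamicRegret_le {n d m : ℕ} {X : Set (Vec d)} {P : OnlineData n d m}
    {dX L F G : ℝ} (hP : IsRegularProblem X P dX L F G) (hn : 0 < n) {x : Fin n → ℕ → Vec d}
    (hx : ∀ i t, x i t ∈ X) (xs : ℕ → Vec d) (T : ℕ) :
    dynamicRegret P x xs T
      ≤ (1 / (n : ℝ)) * ∑ i, ∑ t ∈ Finset.Icc 1 T, (P.f i t (x i t) - P.f i t (xs t))
        + 2 * L * ∑ t ∈ Finset.Icc 1 T, disagreement (fun i => x i t) := by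
  have hn0 : (0 : ℝ) < n := by exact_mod_cast hn
  have hL := hP.L_nonneg
  have hloss : ∀ i, ∀ t ∈ Finset.Icc 1 T, globalLoss P t (x i t)
      ≤ (1 / (n : ℝ)) * ∑ j, P.f j t (x j t) + 2 * L * disagreement (fun i => x i t) := by
    intro i t ht
    have h : ∀ j, P.f j t (x i t) ≤ P.f j t (x j t) + 2 * L * disagreement (fun i => x i t) := by
      intro j
      have h1 := (abs_le.1 (hP.lipschitz_f j t (Finset.mem_Icc.1 ht).1 _ (hx i t) _ (hx j t))).2
      have h2 := mul_le_mul_of_nonneg_left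
        (norm_sub_le_two_mul_disagreement (fun i => x i t) i j) hL
      linarith
    calc globalLoss P t (x i t)
        ≤ (1 / (n : ℝ)) * ∑ j, (P.f j t (x j t) + 2 * L * disagreement (fun i => x i t)) := by
          rw [globalLoss]; gcongr with j; exact h j
      _ = _ := by
          rw [Finset.sum_add_distrib, Finset.sum_const, Finset.card_fin, nsmul_eq_mul]
          field_simp
  have havg : (1 / (n : ℝ)) * ∑ i, ∑ t ∈ Finset.Icc 1 T, globalLoss P t (x i t)
      ≤ ∑ t ∈ Finset.Icc 1 T, ((1 / (n : ℝ)) * ∑ j, P.f j t (x j t)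
        + 2 * L * disagreement (fun i => x i t)) := by
    calc _ ≤ (1 / (n : ℝ)) * ∑ _i : Fin n, ∑ t ∈ Finset.Icc 1 T,
          ((1 / (n : ℝ)) * ∑ j, P.f j t (x j t) + 2 * L * disagreement (fun i => x i t)) := by
          gcongr with i _ t ht; exact hloss i t ht
      _ = _ := by
          rw [Finset.sum_const, Finset.card_fin, nsmul_eq_mul, ← mul_assoc,
            one_div_mul_cancel hn0.ne', one_mul]
  have hswap : ∑ t ∈ Finset.Icc 1 T, (1 / (n : ℝ)) * ∑ j, P.f j t (x j t)
        - ∑ t ∈ Finset.Icc 1 T, globalLoss P t (xs t)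
      = (1 / (n : ℝ)) * ∑ i, ∑ t ∈ Finset.Icc 1 T, (P.f i t (x i t) - P.f i t (xs t)) := by
    simp only [globalLoss]
    rw [← Finset.sum_sub_distrib, Finset.sum_comm, Finset.mul_sum]
    refine Finset.sum_congr rfl fun t _ => ?_
    rw [Finset.sum_sub_distrib, mul_sub]
  rw [Finset.sum_add_distrib, ← Finset.mul_sum] at havg
  rw [dynamicRegret, ← hswap]
  simp only [← Finset.mul_sum] at *
  linarith

/-- The accumulated constraint of node `i` moves by at most `E` when `x_i` is replaced by `x_j`;
then `(u + v)² ≤ 2u² + 2v²`, which yields the 2 in `constD₃`. -/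
theorem IsRegularProblem.squaredFit_le {n d m : ℕ} {X : Set (Vec d)} {P : OnlineData n d m}
    {dX L F G : ℝ} (hP : IsRegularProblem X P dX L F G) (hn : 0 < n) {x : Fin n → ℕ → Vec d}
    (hx : ∀ i t, x i t ∈ X) (T : ℕ) :
    squaredFit P x T
      ≤ 2 / (n : ℝ) * ∑ i, ‖posProj (∑ t ∈ Finset.Icc 1 T, P.g i t (x i t))‖ ^ 2
        + 2 * (2 * L * ∑ t ∈ Finset.Icc 1 T, disagreement (fun i => x i t)) ^ 2 := by
  have hn0 : (0 : ℝ) < n := by exact_mod_cast hn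
  have hL := hP.L_nonneg
  set E := 2 * L * ∑ t ∈ Finset.Icc 1 T, disagreement (fun i => x i t) with hE
  have hpair : ∀ i j, ‖posProj (∑ t ∈ Finset.Icc 1 T, P.g i t (x j t))‖ ^ 2
      ≤ 2 * ‖posProj (∑ t ∈ Finset.Icc 1 T, P.g i t (x i t))‖ ^ 2 + 2 * E ^ 2 := by
    intro i j
    have hdiff : ‖∑ t ∈ Finset.Icc 1 T, P.g i t (x j t) - ∑ t ∈ Finset.Icc 1 T, P.g i t (x i t)‖
        ≤ E := by
      rw [← Finset.sum_sub_distrib, hE, Finset.mul_sum]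
      refine norm_sum_le_of_le _ fun t ht => ?_
      have h1 := hP.lipschitz_g i t (Finset.mem_Icc.1 ht).1 _ (hx j t) _ (hx i t)
      have h2 := mul_le_mul_of_nonneg_left
        (norm_sub_le_two_mul_disagreement (fun i => x i t) j i) hL
      linarith
    have h := (norm_posProj_le_add (∑ t ∈ Finset.Icc 1 T, P.g i t (x j t))
      (∑ t ∈ Finset.Icc 1 T, P.g i t (x i t))).trans (add_le_add_right hdiff _)
    exact (pow_le_pow_left₀ (norm_nonneg _) h 2).trans (by
      nlinarith [sq_nonneg (‖posProj (∑ t ∈ Finset.Icc 1 T, P.g i t (x i t))‖ - E)])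
  calc squaredFit P x T ≤ (1 / (n : ℝ)) * ∑ i, (1 / (n : ℝ)) * ∑ _j : Fin n,
        (2 * ‖posProj (∑ t ∈ Finset.Icc 1 T, P.g i t (x i t))‖ ^ 2 + 2 * E ^ 2) := by
        rw [squaredFit]; gcongr with i _ j; exact hpair i j
    _ = _ := by
        simp only [Finset.sum_const, Finset.card_fin, nsmul_eq_mul]
        simp only [← mul_assoc, one_div_mul_cancel hn0.ne', one_mul]
        rw [Finset.sum_add_distrib, ← Finset.mul_sum, Finset.sum_const, Finset.card_fin,
          nsmul_eq_mul]
        field_simp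

/-! ### Choice of the multipliers -/

theorem theorem1 {n d m : ℕ}
    (Gr : SimpleGraph (Fin n)) (W : Matrix (Fin n) (Fin n) ℝ) (hW : IsNetworkWeight Gr W)
    (hσ : secondEigenvalueModulus W < 1)
    (X : Set (Vec d)) (P : OnlineData n d m) (dX L F G : ℝ)
    (hP : IsRegularProblem X P dX L F G)
    (R : Vec d → ℝ) (gradR : Vec d → Vec d) (μ K : ℝ)
    (hR : IsStronglyConvexMirrorMap X R gradR μ) (hD : IsRegularBregman X R gradR K)
    (a b : ℝ) (hb : 0 < b) (hba : b < a) (ha : a < 1)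
    (x y : Fin n → ℕ → Vec d) (q : Fin n → ℕ → Vec m)
    (hrun : IsAlgorithmRun X P W R gradR
      (fun t => 1 / (t : ℝ) ^ a) (fun t => 1 / (t : ℝ) ^ b) (fun t => 1 / (t : ℝ) ^ (1 - b))
      x y q)
    (xs : ℕ → Vec d) (hxs : IsComparator X P xs) (T : ℕ) (hT : 1 ≤ T) :
    dynamicRegret P x xs T ≤
        constR₁ n (secondEigenvalueModulus W) dX L F G μ K a b * (T : ℝ) ^ (max a (1 - a + b))
          + 2 * K * (T : ℝ) ^ a * pathLength xs T ∧
      squaredFit P x T ≤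
        constD₁ dX F G μ K a b * (T : ℝ) ^ (2 - b)
          + constD₂ G μ K a b * (T : ℝ) ^ (1 + a - b) * pathLength xs T
          + constD₃ n (secondEigenvalueModulus W) L F G μ a * (T : ℝ) ^ (2 + 2 * b - 2 * a) := by
  have hn : 0 < n := Fin.pos_iff_nonempty.2 hW.connected.nonempty
  have hn0 : (0 : ℝ) < n := by exact_mod_cast hn
  have ha0 : 0 < a := hb.trans hba
  have hb1 : b < 1 := hba.trans ha
  have h1a : 0 < 1 - a := by linarith
  have h1b : 0 < 1 - b := by linarith
  have hT1 : (1 : ℝ) ≤ T := by exact_mod_cast hT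
  have hT0 : (0 : ℝ) < T := by linarith
  have hμ := hR.mu_pos
  have hG := hP.G_pos
  have hF := hP.F_pos
  have hK := hD.K_nonneg
  have hdX := hP.diam_pos
  have hx := hrun.x_mem hP.convex_set hW.doublyStochastic
  have hdis := hrun.sum_disagreement_le hn hP hW.symm hW.doublyStochastic hσ hR hb ha0 ha T hT
  have hdis0 : 0 ≤ 2 * L * ∑ t ∈ Finset.Icc 1 T, disagreement (fun i => x i t) :=
    mul_nonneg (mul_nonneg zero_le_two hP.L_nonneg)
      (Finset.sum_nonneg fun t _ => disagreement_nonneg _)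
  have hreg := hP.dynamicRegret_le hn hx xs T
  have hfit := hP.squaredFit_le hn hx T
  have hlag := fun (l : Fin n → Vec m) (hl : ∀ i k, 0 ≤ l i k) =>
    hrun.sum_lagrangian_le hP hW.doublyStochastic hR hD hb hb1 ha0 ha hxs hl T hT
  set E := 2 * L * ∑ t ∈ Finset.Icc 1 T, disagreement (fun i => x i t)
  set Q := constR n (secondEigenvalueModulus W) L F G μ a
  set C := pathLength xs T
  have hC : 0 ≤ C := Finset.sum_nonneg fun t _ => norm_nonneg _
  have hQ : 0 ≤ Q := by
    have h1σ : 0 < 1 - secondEigenvalueModulus W := by linarith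
    have h0σ := secondEigenvalueModulus_nonneg W
    have hL := hP.L_nonneg
    simp only [Q, constR]
    positivity
  set c₁ := constB₁ dX F G ^ 2 / (2 * b) with hc₁
  set c₂ := G ^ 2 / (μ * (1 - a)) with hc₂
  have hc₁0 : 0 ≤ c₁ := by positivity
  have hc₂0 : 0 ≤ c₂ := by positivity
  have hpow : ∀ {r s : ℝ}, r ≤ s → (T : ℝ) ^ r ≤ (T : ℝ) ^ s := fun h =>
    Real.rpow_le_rpow_of_exponent_le hT1 h
  constructor
  · have h := hlag (fun _ => 0) (by simp)
    simp only [inner_zero_left, norm_zero] at h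
    norm_num at h
    have h' : (1 / (n : ℝ)) * ∑ i, ∑ t ∈ Finset.Icc 1 T, (P.f i t (x i t) - P.f i t (xs t))
        ≤ c₁ * (T : ℝ) ^ b + c₂ * (T : ℝ) ^ (1 - a) + 2 * K * dX * (T : ℝ) ^ a
          + 2 * K * (T : ℝ) ^ a * C := by
      rw [one_div_mul_eq_div, div_le_iff₀ hn0]
      simp only [Finset.sum_sub_distrib] at h ⊢
      linarith
    set M := max a (1 - a + b)
    have e1 : (T : ℝ) ^ b ≤ (T : ℝ) ^ M := hpow (hba.le.trans (le_max_left _ _))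
    have e2 : (T : ℝ) ^ (1 - a) ≤ (T : ℝ) ^ M :=
      hpow (le_trans (by linarith) (le_max_right _ _))
    have e3 : (T : ℝ) ^ a ≤ (T : ℝ) ^ M := hpow (le_max_left _ _)
    have e4 : (T : ℝ) ^ (1 - a + b) ≤ (T : ℝ) ^ M := hpow (le_max_right _ _)
    have e5 : constR₁ n (secondEigenvalueModulus W) dX L F G μ K a b
        = Q + c₁ + c₂ + 2 * K * dX := rfl
    rw [e5]
    have f1 := mul_le_mul_of_nonneg_left e1 hc₁0
    have f2 := mul_le_mul_of_nonneg_left e2 hc₂0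
    have f3 := mul_le_mul_of_nonneg_left e3 (by positivity : 0 ≤ 2 * K * dX)
    have f4 := mul_le_mul_of_nonneg_left e4 hQ
    linarith
  · set D := constD G μ a b with hD_def
    have hDeq : D = 2 + 4 * c₂ + 2 / (1 - b) := by
      rw [hD_def, constD, hc₂]; ring
    have hDpos : 0 < D := by rw [hDeq]; positivity
    set U := (T : ℝ) ^ (1 - b) with hU
    have hU1 : 1 ≤ U := Real.one_le_rpow hT1 h1b.le
    have hU0 : 0 < U := by linarith
    -- `Θ` dominates the coefficient of `‖l‖² / 2`: here `b < a` gives `T^(1-a) ≤ U`, and `D / 2`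
    -- collects the three constants.
    set Θ := D / 2 * U with hΘ
    have hΘ0 : 0 < Θ := by positivity
    have hΘle : 1 + U / (1 - b) + 2 * G ^ 2 / (μ * (1 - a)) * (T : ℝ) ^ (1 - a) ≤ Θ := by
      have h1 : (T : ℝ) ^ (1 - a) ≤ U := hpow (by linarith)
      have h2 : 2 * G ^ 2 / (μ * (1 - a)) = 2 * c₂ := by rw [hc₂]; ring
      have h3 := mul_le_mul_of_nonneg_left h1 (by positivity : 0 ≤ 2 * c₂)
      have h4 : Θ = U + U / (1 - b) + 2 * c₂ * U := by rw [hΘ, hDeq]; ring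
      rw [h2, h4]
      linarith
    set p : Fin n → Vec m := fun i => posProj (∑ t ∈ Finset.Icc 1 T, P.g i t (x i t)) with hp
    -- With `s` the accumulated constraint, `l = [s]₊ / Θ` maximizes `⟨l, s⟩ - Θ ‖l‖² / 2` over `l ≥
    -- 0`; the maximum is `‖p‖² / (2Θ)`.
    have h := hlag (fun i => (1 / Θ) • p i) (fun i k => by
      rw [PiLp.smul_apply, smul_eq_mul]
      exact mul_nonneg (by positivity) (posProj_nonneg _ k))
    have hnode : ∀ i, -(2 * F * T) + ‖p i‖ ^ 2 / (2 * Θ)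
        ≤ ∑ t ∈ Finset.Icc 1 T, (P.f i t (x i t) - P.f i t (xs t))
          + inner ℝ ((1 / Θ) • p i) (∑ t ∈ Finset.Icc 1 T, P.g i t (x i t))
          - ‖(1 / Θ) • p i‖ ^ 2 / 2 * (1 + U / (1 - b)
            + 2 * G ^ 2 / (μ * (1 - a)) * (T : ℝ) ^ (1 - a)) := by
      intro i
      have h1 : -(2 * F * T) ≤ ∑ t ∈ Finset.Icc 1 T, (P.f i t (x i t) - P.f i t (xs t)) := by
        calc -(2 * F * T) = ∑ _t ∈ Finset.Icc 1 T, -(2 * F) := by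
              rw [Finset.sum_const, Nat.card_Icc, nsmul_eq_mul, Nat.add_sub_cancel]; ring
          _ ≤ _ := by
              refine Finset.sum_le_sum fun t ht => ?_
              have ht1 := (Finset.mem_Icc.1 ht).1
              linarith [(abs_le.1 (hP.bound_f i t ht1 _ (hx i t))).1,
                (abs_le.1 (hP.bound_f i t ht1 _ (hxs t ht1).1.1)).2]
      have h2 : inner ℝ ((1 / Θ) • p i) (∑ t ∈ Finset.Icc 1 T, P.g i t (x i t))
          = ‖p i‖ ^ 2 / Θ := by
        rw [real_inner_smul_left, hp, inner_posProj_self]; ring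
      have h3 : ‖(1 / Θ) • p i‖ ^ 2 / 2 * (1 + U / (1 - b)
            + 2 * G ^ 2 / (μ * (1 - a)) * (T : ℝ) ^ (1 - a)) ≤ ‖p i‖ ^ 2 / (2 * Θ) := by
        calc _ ≤ ‖(1 / Θ) • p i‖ ^ 2 / 2 * Θ := by gcongr
          _ = _ := by
            rw [norm_smul, Real.norm_of_nonneg (by positivity)]
            field_simp
      have h4 : ‖p i‖ ^ 2 / Θ = ‖p i‖ ^ 2 / (2 * Θ) + ‖p i‖ ^ 2 / (2 * Θ) := by
        field_simp; ring
      linarith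
    have hsum := (Finset.sum_le_sum fun i _ => hnode i).trans h
    rw [Finset.sum_add_distrib, Finset.sum_const, Finset.card_fin, nsmul_eq_mul,
      ← Finset.sum_div] at hsum
    have hTle : ∀ {r : ℝ}, r ≤ 1 → (T : ℝ) ^ r ≤ T := fun h => by
      simpa using hpow h
    have g1 := mul_le_mul_of_nonneg_left (hTle hb1.le) hc₁0
    have g2 := mul_le_mul_of_nonneg_left (hTle (by linarith : 1 - a ≤ 1)) hc₂0
    have g3 := mul_le_mul_of_nonneg_left (hTle ha.le) (by positivity : 0 ≤ 2 * K * dX)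
    have hN : (∑ i, ‖p i‖ ^ 2) / (2 * Θ) ≤ n * ((2 * F + 2 * K * dX + c₁ + c₂ + 2 * K * dX) * T
        + 2 * K * (T : ℝ) ^ a * C) := by
      -- One of the two terms `2 * K * dX` in `constD₁` is slack.
      have g4 : c₁ * (T : ℝ) ^ b + c₂ * (T : ℝ) ^ (1 - a) + 2 * K * dX * (T : ℝ) ^ a
            + 2 * K * (T : ℝ) ^ a * C + 2 * F * T
          ≤ (2 * F + 2 * K * dX + c₁ + c₂ + 2 * K * dX) * T + 2 * K * (T : ℝ) ^ a * C := by
        have : 0 ≤ 2 * K * dX * T := by positivity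
        linarith
      have g5 := mul_le_mul_of_nonneg_left g4 hn0.le
      linarith
    rw [div_le_iff₀ (by positivity)] at hN
    have hmain : 2 / (n : ℝ) * ∑ i, ‖p i‖ ^ 2
        ≤ constD₁ dX F G μ K a b * (T : ℝ) ^ (2 - b)
          + constD₂ G μ K a b * (T : ℝ) ^ (1 + a - b) * C := by
      have p1 : (T : ℝ) ^ (2 - b) = T * U := by
        rw [hU, show 2 - b = 1 + (1 - b) by ring, Real.rpow_add hT0, Real.rpow_one]
      have p2 : (T : ℝ) ^ (1 + a - b) = (T : ℝ) ^ a * U := by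
        rw [hU, show 1 + a - b = a + (1 - b) by ring, Real.rpow_add hT0]
      have p3 : constD₁ dX F G μ K a b
          = 2 * D * (2 * F + 2 * K * dX + c₁ + c₂ + 2 * K * dX) := rfl
      have p4 : constD₂ G μ K a b = 4 * K * D := rfl
      calc _ ≤ 2 / (n : ℝ) * (n * ((2 * F + 2 * K * dX + c₁ + c₂ + 2 * K * dX) * T
            + 2 * K * (T : ℝ) ^ a * C) * (2 * Θ)) := by gcongr
        _ = _ := by
          rw [p1, p2, p3, p4, hΘ]
          field_simp
          ring
    have hEsq : 2 * E ^ 2 ≤ constD₃ n (secondEigenvalueModulus W) L F G μ a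
        * (T : ℝ) ^ (2 + 2 * b - 2 * a) := by
      have q1 : (T : ℝ) ^ (2 + 2 * b - 2 * a) = ((T : ℝ) ^ (1 - a + b)) ^ 2 := by
        rw [← Real.rpow_natCast, ← Real.rpow_mul hT0.le]
        congr 1; push_cast; ring
      have q2 : constD₃ n (secondEigenvalueModulus W) L F G μ a = 2 * Q ^ 2 := rfl
      have q3 := pow_le_pow_left₀ hdis0 hdis 2
      rw [q1, q2]
      linarith
    linarith
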